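/- **Setting.** Fix a finite universe $\mathcal U$ and a size parameter $n$ (for instance $n=|\mathcal U|$), a stream length $m\ge 2$ polynomially related to $n$ ($m\le n^b$, $n\le m^b$), a window parameter $W\ge1$, and a word size $w=\Theta(\log m)$ ($m<2^w$, $w\le\kappa\log m$). A streaming algorithm has a memory of finitely many $w$-bit cells, initially zero. On each arriving update it runs a randomized program that in one step reads a cell, writes a cell, or draws a uniformly random word, and at the end returns its current output. Its update time is the worst-case number of steps per update (the arrival of the update counting as one step). Its space, in bits, is $w$ times the number of cells plus the logarithm (base 2) of the number of control states of its programs. Algorithms may depend on all parameters. A private algorithm returns a pair $(x,b)$, $b\ge0$, and at the end of the stream releases a sample of the Laplace distribution with mean $x$ and scale $b$ (the point mass at $x$ if $b=0$). Streams are neighboring if they have the same length and differ in at most one update; $(\varepsilon,\delta)$-differential privacy refers to neighboring streams of length $m$ and to the number released at the end. $\Delta_f$ is the maximum of $|f(D)-f(D')|$ over neighboring $D,D'$ consisting of $\min(m,W)$ updates. A real function $f$ of streams is $(\rho,\beta(\rho))$-smooth if $0<\beta(\rho)\le\rho$ and, for all nonempty streams of length at most $m$: $1\le f\le n^q$; $f(B)\le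 f(A)$ whenever $B$ is a suffix of $A$; and if $B$ is a suffix of $A$ with $(1-\beta(\rho))f(A)\le f(B)$, then $(1-\rho)f(AC)\le f(BC)$ for every continuation $C$ (with $AC$ of length at most $m$). **Theorem (DP smooth histogram framework).** For every $c>0$ (and fixed $q,b,\kappa$) there are constants $C_1,C_2,C_3\ge 1$ and $k\in\mathbb N$, depending only on these, such that the following holds for all $\mathcal U,m,n,w,W$ as above, all $\alpha\in(0,1)$ and $\varepsilon>0$. Let $\eta=\min(\varepsilon,1)$ and $0<\rho\le\frac{\alpha\eta}{C_1\log m}$, and let $f$ be $(\rho,\beta(\rho))$-smooth. Suppose that for all $a,d\in(0,1)$ there is an insertion-only streaming algorithm that uses space at most $\mathcal S(a,d,m,n)$ and update time at most $\mathcal T(a,d,m,n)$ and whose output, after any nonempty stream $D$ of length at most $m$, lies in $[(1-a)f(D),(1+a)f(D)]$ with probability at least $1-d$. Put $\delta=m^{-c}$ and $\delta'=\delta/(mn)^k$. Then there is a streaming algorithm $\mathcal A'$ (in the sliding window model) such that, $\mathcal W$ denoting the last $\min(m,W)$ updates of the stream: 1. (Privacy) $\mathcal A'$ is $(\varepsilon,\delta)$-differentially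 private. 2. (Accuracy) On every stream of length $m$, with probability at least $1-m^{-c}$ the released number $\widehat f(\mathcal W)$ satisfies $$(1-\alpha)f(\mathcal W)-\frac{6c\,\Delta_f\log m}{\varepsilon}\le\widehat f(\mathcal W)\le(1+\alpha)f(\mathcal W)+\frac{6c\,\Delta_f\log m}{\varepsilon}.$$ 3. (Space and time) $\mathcal A'$ uses space at most $C_3\,\frac1{\beta(\rho)}\bigl(\mathcal S(\beta(\rho)/C_2,\delta',m,n)+\log m\bigr)\log m$ and update time at most $C_3\,\frac1{\beta(\rho)}\,\mathcal T(\beta(\rho)/C_2,\delta',m,n)\log m$. -/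

import Mathlib

open scoped NNReal ENNReal

noncomputable section

namespace DPHist

/-! ### The machine model -/

/-- A machine word of `w` bits, read as a natural number below `2 ^ w`. -/
abbrev Word (w : ℕ) : Type := Fin (2 ^ w)

/-- The contents of a memory of `s` cells, each holding one word of `w` bits. -/
abbrev Mem (w s : ℕ) : Type := Fin s → Word w

/-- The memory all of whose cells hold the word `0`. -/
def zeroMem (w s : ℕ) : Mem w s := fun _ => ⟨0, Nat.two_pow_pos w⟩

/-- A randomized random-access program on a memory of `s` cells of `w` bits. In one step it reads a
cell, writes a cell, or draws a uniformly random word; it stops by returning a value. -/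
inductive Prog (w s : ℕ) (O : Type) : Type
  | ret (o : O) : Prog w s O
  | read (i : Fin s) (k : Word w → Prog w s O) : Prog w s O
  | write (i : Fin s) (x : Word w) (p : Prog w s O) : Prog w s O
  | rand (k : Word w → Prog w s O) : Prog w s O

namespace Prog

variable {w s : ℕ} {O : Type}

/-- The joint law of the returned value and the final memory. -/
def run : Prog w s O → Mem w s → PMF (O × Mem w s)
  | ret o, M => PMF.pure (o, M)
  | read i k, M => (k (M i)).run M
  | write i x p, M => p.run (Function.update M i x)
  | rand k, M => (PMF.uniformOfFintype (Word w)).bind fun x => (k x).run M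

/-- The worst-case number of steps. -/
def cost : Prog w s O → ℕ
  | ret _ => 0
  | read _ k => 1 + Finset.univ.sup fun x => (k x).cost
  | write _ _ p => 1 + p.cost
  | rand k => 1 + Finset.univ.sup fun x => (k x).cost

/-- The control states that the program can go through: the distinct programs that may remain to be
executed at some moment. What the processor remembers while it is running is exactly which one of
them is left, so the logarithm of their number is the size of its working memory. -/
def residuals : Prog w s O → Set (Prog w s O)
  | ret o => {ret o}
  | read i k => insert (read i k) (⋃ x, (k x).residuals)
  | write i x p => insert (write i x p) p.residuals
  | rand k => insert (rand k) (⋃ x, (k x).residuals)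

end Prog

/-- A one-pass streaming algorithm over the universe `U` on a machine with words of `w` bits: it has
`cells` memory cells, all initially zero, and on every arriving update `u` it executes the program
`step u`, which modifies the memory and returns the current output. -/
structure StreamAlg (w : ℕ) (U O : Type) where
  cells : ℕ
  step : U → Prog w cells O

namespace StreamAlg

variable {w : ℕ} {U O : Type}

/-- The joint law of the latest output (`none` before the first update) and of the memory after the
updates of the list have been processed from left to right. -/
def exec (A : StreamAlg w U O) (σ : List U) : PMF (Option O × Mem w A.cells) :=
  σ.foldl (fun μ u => μ.bind fun x => ((A.step u).run x.2).map fun y => (some y.1, y.2))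
    (PMF.pure (none, zeroMem w A.cells))

/-- The law of the output after the whole stream has been processed. -/
def outputLaw (A : StreamAlg w U O) (σ : List U) : PMF (Option O) := (A.exec σ).map Prod.fst

/-- Space in bits: the memory cells together with the working memory (see `Prog.residuals`). -/
def spaceBits (A : StreamAlg w U O) : ℝ :=
  (A.cells : ℝ) * w + Real.logb 2 ((⋃ u, (A.step u).residuals).ncard : ℝ)

/-- Processing one update, whose arrival itself counts as one step, takes at most `t` steps. -/
def UpdateTimeLE (A : StreamAlg w U O) (t : ℝ) : Prop :=
  ∀ u, ((1 + (A.step u).cost : ℕ) : ℝ) ≤ t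

/-- In the insertion-only model, on every nonempty stream of length at most `m`, the output is
between `(1 - a) f` and `(1 + a) f` with probability at least `1 - d`. -/
def IsApprox (A : StreamAlg w U ℝ) (f : List U → ℝ) (m : ℕ) (a d : ℝ) : Prop :=
  ∀ σ : List U, σ ≠ [] → σ.length ≤ m →
    ENNReal.ofReal (1 - d) ≤ (A.outputLaw σ).toOuterMeasure
      {o | ∃ v, o = some v ∧ (1 - a) * f σ ≤ v ∧ v ≤ (1 + a) * f σ}

end StreamAlg

/-! ### Laplace noise and differential privacy -/

/-- The Laplace distribution with mean `μ` and scale `b`; for `b = 0` the point mass at `μ`. -/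
def laplace (μ : ℝ) (b : ℝ≥0) : MeasureTheory.Measure ℝ :=
  if b = 0 then MeasureTheory.Measure.dirac μ
  else MeasureTheory.volume.withDensity
    fun x => ENNReal.ofReal (1 / (2 * b) * Real.exp (-|x - μ| / b))

/-- The law of the number that is released at the end of the stream by an algorithm whose output is
a pair `(x, b)`: a fresh sample of the Laplace distribution with mean `x` and scale `b`. -/
def StreamAlg.releaseLaw {w : ℕ} {U : Type} (A : StreamAlg w U (ℝ × ℝ≥0)) (σ : List U) :
    MeasureTheory.Measure ℝ :=
  MeasureTheory.Measure.sum fun o : ℝ × ℝ≥0 => A.outputLaw σ (some o) • laplace o.1 o.2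

/-- Two streams of the same length that differ in at most one update. -/
def Neighboring {U : Type} (σ τ : List U) : Prop :=
  ∃ (l r : List U) (a b : U), σ = l ++ a :: r ∧ τ = l ++ b :: r

/-- `(ε, δ)`-differential privacy of a mechanism on streams of length `m`. -/
def IsDP {U : Type} (M : List U → MeasureTheory.Measure ℝ) (m : ℕ) (ε δ : ℝ) : Prop :=
  ∀ σ τ : List U, σ.length = m → τ.length = m → Neighboring σ τ →
    ∀ E : Set ℝ, MeasurableSet E →
      M σ E ≤ ENNReal.ofReal (Real.exp ε) * M τ E + ENNReal.ofReal δ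

/-- The global sensitivity of `f` on datasets consisting of `ℓ` updates. -/
def globalSensitivity {U : Type} (f : List U → ℝ) (ℓ : ℕ) : ℝ :=
  sSup {d | ∃ σ τ : List U, σ.length = ℓ ∧ τ.length = ℓ ∧ Neighboring σ τ ∧ d = |f σ - f τ|}

/-! ### Smooth functions -/

/-- `f` is `(ρ, ξ)`-smooth on the nonempty streams of length at most `m`, with the polynomial bound
`n ^ q`. Here `B <:+ A` says that `B` is a suffix of `A`. -/
structure IsSmooth {U : Type} (f : List U → ℝ) (m n q : ℕ) (ρ ξ : ℝ) : Prop where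
  one_le : ∀ A : List U, A ≠ [] → A.length ≤ m → 1 ≤ f A
  mono : ∀ A B : List U, B ≠ [] → B <:+ A → A.length ≤ m → f B ≤ f A
  bounded : ∀ A : List U, A ≠ [] → A.length ≤ m → f A ≤ (n : ℝ) ^ q
  pos : 0 < ξ
  le : ξ ≤ ρ
  smooth : ∀ A B C : List U, B ≠ [] → B <:+ A → (A ++ C).length ≤ m →
    (1 - ξ) * f A ≤ f B → (1 - ρ) * f (A ++ C) ≤ f (B ++ C)

end DPHist

end

/-!
Every update starts a new copy of the insertion-only algorithm, and a copy is discarded once it lies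
between two others whose estimates differ by a factor of at most `1 - β / 2`. Since `1 ≤ f ≤ n ^ q`,
only `O(log n / β)` copies survive, and by smoothness the last one started before the window still
approximates `f` on the window up to a factor `1 ± 2 ρ`. When no copy errs, which fails with
probability at most `m² δ'`, the estimates `v` on neighbouring streams differ by at most
`Δ + O(ρ) v`, which is masked by Laplace noise of scale proportional to `(Δ + 8 ρ v) / ε`. This
scale depends on the data, but only through a factor of at most `1 + 9 ρ`: the two densities are
comparable within `O(log m)` scales of the mean, and the tails beyond are charged to `δ`.

In the machine, a slot is cleared in a single step by overwriting its header: cells written under an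
older time stamp are read as zero.
-/

noncomputable section

namespace DPHist

/-! ### Expectations -/

/-- The expectation of a nonnegative function under a discrete law. -/
def expect {α : Type*} (μ : PMF α) (φ : α → ℝ≥0∞) : ℝ≥0∞ := ∑' a, μ a * φ a

section expect

variable {α γ : Type*}

theorem expect_pure (a : α) (φ : α → ℝ≥0∞) : expect (PMF.pure a) φ = φ a := by
  rw [expect, tsum_eq_single a fun b hb => by simp [PMF.pure_apply, hb]]
  simp

theorem expect_bind (μ : PMF α) (k : α → PMF γ) (φ : γ → ℝ≥0∞) :
    expect (μ.bind k) φ = expect μ fun a => expect (k a) φ := by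
  simp_rw [expect, PMF.bind_apply, ← ENNReal.tsum_mul_right, ← ENNReal.tsum_mul_left]
  rw [ENNReal.tsum_comm]
  simp_rw [mul_assoc]

theorem expect_map (μ : PMF α) (g : α → γ) (φ : γ → ℝ≥0∞) :
    expect (μ.map g) φ = expect μ fun a => φ (g a) := by
  simp_rw [← PMF.bind_pure_comp, expect_bind, Function.comp_apply, expect_pure]

theorem expect_mono (μ : PMF α) {φ ψ : α → ℝ≥0∞} (h : ∀ a, φ a ≤ ψ a) :
    expect μ φ ≤ expect μ ψ :=
  ENNReal.tsum_le_tsum fun a => mul_le_mul_right (h a) (μ a)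

theorem expect_add (μ : PMF α) (φ ψ : α → ℝ≥0∞) :
    expect μ (fun a => φ a + ψ a) = expect μ φ + expect μ ψ := by
  simp_rw [expect, mul_add]
  exact ENNReal.tsum_add

theorem expect_const (μ : PMF α) (C : ℝ≥0∞) : expect μ (fun _ => C) = C := by
  rw [expect, ENNReal.tsum_mul_right, μ.tsum_coe, one_mul]

theorem expect_indicator (μ : PMF α) (s : Set α) :
    expect μ (s.indicator 1) = μ.toOuterMeasure s := by
  rw [expect, PMF.toOuterMeasure_apply]
  refine tsum_congr fun a => ?_
  by_cases h : a ∈ s <;> simp [h]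

theorem toOuterMeasure_add_compl (μ : PMF α) (s : Set α) :
    μ.toOuterMeasure s + μ.toOuterMeasure sᶜ = 1 := by
  simp_rw [← expect_indicator, ← expect_add]
  exact (congrArg (expect μ) (Set.indicator_self_add_compl s 1)).trans (expect_const μ 1)

theorem expect_le_of_forall_mem (μ : PMF α) {φ : α → ℝ≥0∞} {G : Set α} {K : ℝ≥0∞}
    (hG : ∀ a ∈ G, φ a ≤ K) (hφ : ∀ a, φ a ≤ 1) : expect μ φ ≤ K + μ.toOuterMeasure Gᶜ := by
  rw [← expect_indicator, ← expect_const μ K, ← expect_add]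
  refine expect_mono μ fun a => ?_
  by_cases ha : a ∈ G
  · exact le_add_right (hG a ha)
  · simpa [ha] using le_add_left (hφ a)

theorem le_expect_of_forall_mem (μ : PMF α) {φ : α → ℝ≥0∞} {G : Set α} {K : ℝ≥0∞}
    (hG : ∀ a ∈ G, K ≤ φ a) (hK : K ≤ 1) : K ≤ expect μ φ + μ.toOuterMeasure Gᶜ := by
  rw [← expect_indicator, ← expect_add]
  refine (expect_const μ K).ge.trans (expect_mono μ fun a => ?_)
  by_cases ha : a ∈ G
  · exact le_add_right (hG a ha)
  · simpa [ha] using le_add_left hK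

end expect

/-! ### Sequential composition of programs -/

namespace Prog

variable {w s : ℕ} {O O' : Type}

/-- Run `p`, then continue with the program selected by the value that `p` returns. -/
def bind : Prog w s O → (O → Prog w s O') → Prog w s O'
  | ret o, k => k o
  | read i r, k => read i fun x => (r x).bind k
  | write i x p, k => write i x (p.bind k)
  | rand r, k => rand fun x => (r x).bind k

/-- The expectation of a function `Φ` of the returned value and the final memory, as a function of
the initial memory: a quantitative weakest precondition. -/
def wp : Prog w s O → (O × Mem w s → ℝ≥0∞) → Mem w s → ℝ≥0∞
  | ret o, Φ, M => Φ (o, M)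
  | read i k, Φ, M => (k (M i)).wp Φ M
  | write i x p, Φ, M => p.wp Φ (Function.update M i x)
  | rand k, Φ, M => expect (PMF.uniformOfFintype (Word w)) fun x => (k x).wp Φ M

theorem expect_run (p : Prog w s O) (Φ : O × Mem w s → ℝ≥0∞) (M : Mem w s) :
    expect (p.run M) Φ = p.wp Φ M := by
  induction p generalizing M with
  | ret o => simp [run, wp, expect_pure]
  | read i k ih => simp [run, wp, ih]
  | write i x p ih => simp [run, wp, ih]
  | rand k ih => simp [run, wp, ih, expect_bind]

theorem wp_mono (p : Prog w s O) {Φ Ψ : O × Mem w s → ℝ≥0∞} (h : ∀ y, Φ y ≤ Ψ y) (M : Mem w s) :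
    p.wp Φ M ≤ p.wp Ψ M := by
  simp_rw [← expect_run]
  exact expect_mono _ h

theorem wp_add (p : Prog w s O) (Φ Ψ : O × Mem w s → ℝ≥0∞) (M : Mem w s) :
    p.wp (fun y => Φ y + Ψ y) M = p.wp Φ M + p.wp Ψ M := by
  simp_rw [← expect_run]
  exact expect_add _ _ _

theorem wp_const (p : Prog w s O) (C : ℝ≥0∞) (M : Mem w s) : p.wp (fun _ => C) M = C := by
  rw [← expect_run]
  exact expect_const _ _

theorem wp_bind (p : Prog w s O) (k : O → Prog w s O') (Φ : O' × Mem w s → ℝ≥0∞) (M : Mem w s) :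
    (p.bind k).wp Φ M = p.wp (fun y => (k y.1).wp Φ y.2) M := by
  induction p generalizing M with
  | ret o => simp [bind, wp]
  | read i k ih => simp [bind, wp, ih]
  | write i x p ih => simp [bind, wp, ih]
  | rand k ih => simp [bind, wp, ih]

theorem cost_bind_le (p : Prog w s O) (k : O → Prog w s O') {C : ℕ} (hk : ∀ o, (k o).cost ≤ C) :
    (p.bind k).cost ≤ p.cost + C := by
  have sup_le {r : Word w → Prog w s O} (ih : ∀ x, ((r x).bind k).cost ≤ (r x).cost + C) :
      (Finset.univ.sup fun x => ((r x).bind k).cost)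
        ≤ (Finset.univ.sup fun x => (r x).cost) + C :=
    Finset.sup_le fun x _ => (ih x).trans <| Nat.add_le_add_right
      (Finset.le_sup (f := fun x => (r x).cost) (Finset.mem_univ x)) C
  induction p with
  | ret o => simpa [bind, cost] using hk o
  | read i r ih => simpa only [bind, cost, add_assoc] using Nat.add_le_add_left (sup_le ih) 1
  | write i x p ih => simpa only [bind, cost, add_assoc] using Nat.add_le_add_left ih 1
  | rand r ih => simpa only [bind, cost, add_assoc] using Nat.add_le_add_left (sup_le ih) 1

theorem mem_residuals_self (p : Prog w s O) : p ∈ p.residuals := by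
  cases p <;> simp [residuals]

theorem finite_residuals (p : Prog w s O) : p.residuals.Finite := by
  induction p with
  | ret o => simp [residuals]
  | read i k ih => exact (Set.finite_iUnion ih).insert _
  | write i x p ih => exact ih.insert _
  | rand k ih => exact (Set.finite_iUnion ih).insert _

theorem residuals_bind_subset (p : Prog w s O) (k : O → Prog w s O') {T : Set (Prog w s O')}
    (hp : ∀ r ∈ p.residuals, r.bind k ∈ T)
    (hk : ∀ o, ret o ∈ p.residuals → (k o).residuals ⊆ T) : (p.bind k).residuals ⊆ T := by
  induction p with
  | ret o => exact hk o (mem_residuals_self _)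
  | read i r ih =>
    refine Set.insert_subset (hp _ (mem_residuals_self _)) <| Set.iUnion_subset fun x => ih x
      (fun r' hr' => hp r' ?_) fun o ho => hk o ?_
    exacts [.inr (Set.mem_iUnion_of_mem x hr'), .inr (Set.mem_iUnion_of_mem x ho)]
  | write i x p ih =>
    exact Set.insert_subset (hp _ (mem_residuals_self _)) <|
      ih (fun r' hr' => hp r' (.inr hr')) fun o ho => hk o (.inr ho)
  | rand r ih =>
    refine Set.insert_subset (hp _ (mem_residuals_self _)) <| Set.iUnion_subset fun x => ih x
      (fun r' hr' => hp r' ?_) fun o ho => hk o ?_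
    exacts [.inr (Set.mem_iUnion_of_mem x hr'), .inr (Set.mem_iUnion_of_mem x ho)]

end Prog

/-! ### A machine that runs several copies of a program -/

/-- The addresses of a memory with `L` slots, each simulating `c` cells: one clock, one header per
slot, and a stamp and a value per simulated cell. The header of a slot is the time at which the copy
that lives there was started, and `0` if the slot is free. A value counts only if its stamp agrees
with the header of its slot; otherwise the simulated cell holds `0`. A slot is thus reset in a
single step, by changing its header. -/
abbrev Loc (L c : ℕ) : Type := Unit ⊕ Fin L ⊕ (Fin L × Fin c) ⊕ (Fin L × Fin c)

/-- The number of cells of the machine. -/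
abbrev numCells (L c : ℕ) : ℕ := Fintype.card (Loc L c)

/-- The word `0`. -/
def zeroWord (w : ℕ) : Word w := ⟨0, Nat.two_pow_pos w⟩

/-- The successor of a word modulo `2 ^ w`. -/
def succWord {w : ℕ} (x : Word w) : Word w :=
  ⟨((x : ℕ) + 1) % 2 ^ w, Nat.mod_lt _ (Nat.two_pow_pos w)⟩

section layout

variable {L c : ℕ}

/-- The numbering of the addresses. -/
def addr : Loc L c ≃ Fin (numCells L c) := Fintype.equivFin _

/-- The cell of the clock. -/
def clk : Fin (numCells L c) := addr (.inl ())

/-- The header of a slot. -/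
def hdr (i : Fin L) : Fin (numCells L c) := addr (.inr (.inl i))

/-- The stamp of a simulated cell. -/
def stamp (i : Fin L) (j : Fin c) : Fin (numCells L c) := addr (.inr (.inr (.inl (i, j))))

/-- The value of a simulated cell. -/
def val (i : Fin L) (j : Fin c) : Fin (numCells L c) := addr (.inr (.inr (.inr (i, j))))

end layout

namespace Prog

variable {w c L : ℕ} {O : Type}

/-- The program that simulates `p` on the slot `i` whose header is `h`. -/
def onSlot (i : Fin L) (h : Word w) : Prog w c O → Prog w (numCells L c) O
  | ret o => ret o
  | read j k => read (stamp i j) fun x =>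
      if x = h then read (val i j) fun y => onSlot i h (k y) else onSlot i h (k (zeroWord w))
  | write j x p => write (stamp i j) h (write (val i j) x (onSlot i h p))
  | rand k => rand fun x => onSlot i h (k x)

/-- The memory simulated by the slot `i` if its header is `h`. -/
def view (M : Mem w (numCells L c)) (i : Fin L) (h : Word w) : Mem w c :=
  fun j => if M (stamp i j) = h then M (val i j) else zeroWord w

/-- The part of the effect of simulating programs on the slot `i` with header `h` that does not
depend on the programs; `M` is the memory before the simulation and `M'` the memory after it. -/
structure Frame (i : Fin L) (h : Word w) (M M' : Mem w (numCells L c)) : Prop where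
  clk_eq : M' clk = M clk
  stamp_eq : ∀ i' ≠ i, ∀ j, M' (stamp i' j) = M (stamp i' j)
  val_eq : ∀ i' ≠ i, ∀ j, M' (val i' j) = M (val i' j)
  stamp_or : ∀ j, M' (stamp i j) = M (stamp i j) ∨ M' (stamp i j) = h

theorem Frame.refl (i : Fin L) (h : Word w) (M : Mem w (numCells L c)) : Frame i h M M :=
  ⟨rfl, fun _ _ _ => rfl, fun _ _ _ => rfl, fun _ => .inl rfl⟩

theorem Frame.trans {i : Fin L} {h : Word w} {M M' M'' : Mem w (numCells L c)}
    (h₁ : Frame i h M M') (h₂ : Frame i h M' M'') : Frame i h M M'' where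
  clk_eq := h₂.clk_eq.trans h₁.clk_eq
  stamp_eq i' hi j := (h₂.stamp_eq i' hi j).trans (h₁.stamp_eq i' hi j)
  val_eq i' hi j := (h₂.val_eq i' hi j).trans (h₁.val_eq i' hi j)
  stamp_or j := (h₂.stamp_or j).elim (fun e => e ▸ h₁.stamp_or j) .inr

theorem Frame.view_eq {i : Fin L} {h : Word w} {M M' : Mem w (numCells L c)}
    (hM : Frame i h M M') {i' : Fin L} (hi : i' ≠ i) (h' : Word w) :
    view M' i' h' = view M i' h' := by
  funext j
  simp only [view, hM.stamp_eq i' hi, hM.val_eq i' hi]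

theorem frame_write (i : Fin L) (h : Word w) (M : Mem w (numCells L c)) (j : Fin c) (x : Word w) :
    Frame i h M (Function.update (Function.update M (stamp i j) h) (val i j) x) where
  clk_eq := by simp [clk, stamp, val]
  stamp_eq i' hi j' := by simp [stamp, val, hi]
  val_eq i' hi j' := by simp [stamp, val, hi]
  stamp_or j' := by by_cases e : j' = j <;> simp [stamp, val, e]

theorem view_write (i : Fin L) (h : Word w) (M : Mem w (numCells L c)) (j : Fin c) (x : Word w) :
    view (Function.update (Function.update M (stamp i j) h) (val i j) x) i h
      = Function.update (view M i h) j x := by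
  funext j'
  by_cases e : j' = j
  · simp [view, stamp, val, e]
  · simp only [view, Function.update_of_ne e]
    rw [Function.update_of_ne (by simp [stamp, val]), Function.update_of_ne (by simp [stamp, e]),
      Function.update_of_ne (by simp [val, e]), Function.update_of_ne (by simp [stamp, val])]

theorem wp_onSlot_le (i : Fin L) (h : Word w) (p : Prog w c O)
    (Φ : O × Mem w (numCells L c) → ℝ≥0∞) (φ : O × Mem w c → ℝ≥0∞) (M : Mem w (numCells L c))
    (hΦ : ∀ o M', Frame i h M M' → Φ (o, M') ≤ φ (o, view M' i h)) :
    (onSlot i h p).wp Φ M ≤ p.wp φ (view M i h) := by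
  induction p generalizing M with
  | ret o => exact hΦ o M (Frame.refl i h M)
  | read j k ih =>
    simp only [onSlot, wp, view]
    split_ifs <;> exact ih _ M hΦ
  | write j x p ih =>
    simp only [onSlot, wp]
    rw [← view_write]
    exact ih _ fun o M' hM' => hΦ o M' ((frame_write i h M j x).trans hM')
  | rand k ih => exact expect_mono _ fun x => ih x M hΦ

theorem cost_onSlot_le (i : Fin L) (h : Word w) (p : Prog w c O) :
    (onSlot i h p).cost ≤ 2 * p.cost := by
  have le_two_mul_sup {k : Word w → Prog w c O}
      (ih : ∀ x, (onSlot i h (k x)).cost ≤ 2 * (k x).cost) (x : Word w) :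
      (onSlot i h (k x)).cost ≤ 2 * Finset.univ.sup fun x => (k x).cost :=
    (ih x).trans <| Nat.mul_le_mul_left 2 <|
      Finset.le_sup (f := fun x => (k x).cost) (Finset.mem_univ x)
  induction p with
  | ret o => simp [onSlot, cost]
  | read j k ih =>
    have slot_cost_le : (Finset.univ.sup fun x =>
        (if x = h then read (val i j) fun y => onSlot i h (k y)
          else onSlot i h (k (zeroWord w))).cost)
          ≤ 1 + 2 * Finset.univ.sup fun x => (k x).cost := by
      refine Finset.sup_le fun x _ => ?_
      split_ifs
      · exact Nat.add_le_add_left (Finset.sup_le fun y _ => le_two_mul_sup ih y) 1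
      · exact (le_two_mul_sup ih _).trans (Nat.le_add_left _ _)
    simp only [onSlot, cost]
    omega
  | write j x p ih => simp only [onSlot, cost]; omega
  | rand k ih =>
    have := Finset.sup_le fun x (_ : x ∈ Finset.univ) => le_two_mul_sup ih x
    simp only [onSlot, cost]
    omega

/-- The control states of the simulation that correspond to one control state of the simulated
program; those with the flag `true` occur between the access to a stamp and that to its value. -/
def slotState (i : Fin L) (h : Word w) : Prog w c O → Bool → Prog w (numCells L c) O
  | read j k, true => read (val i j) fun y => onSlot i h (k y)
  | write j x p, true => write (val i j) x (onSlot i h p)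
  | p, _ => onSlot i h p

theorem residuals_onSlot_subset (i : Fin L) (h : Word w) (p : Prog w c O)
    {T : Set (Prog w (numCells L c) O)} (hT : ∀ r ∈ p.residuals, ∀ b, slotState i h r b ∈ T) :
    (onSlot i h p).residuals ⊆ T := by
  have self := hT p (mem_residuals_self p)
  induction p with
  | ret o => exact Set.singleton_subset_iff.2 (self false)
  | read j k ih =>
    have next (x) : (onSlot i h (k x)).residuals ⊆ T :=
      have hk r (hr : r ∈ (k x).residuals) := hT r (.inr (Set.mem_iUnion_of_mem x hr))
      ih x hk (hk _ (mem_residuals_self _))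
    refine Set.insert_subset (self false) (Set.iUnion_subset fun x => ?_)
    dsimp only
    split_ifs
    · exact Set.insert_subset (self true) (Set.iUnion_subset next)
    · exact next _
  | write j x p ih =>
    have hp r (hr : r ∈ p.residuals) := hT r (.inr hr)
    exact Set.insert_subset (self false) <| Set.insert_subset (self true) <|
      ih hp (hp _ (mem_residuals_self _))
  | rand k ih =>
    refine Set.insert_subset (self false) (Set.iUnion_subset fun x => ?_)
    have hk r (hr : r ∈ (k x).residuals) := hT r (.inr (Set.mem_iUnion_of_mem x hr))
    exact ih x hk (hk _ (mem_residuals_self _))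

theorem ret_mem_residuals_of_onSlot {i : Fin L} {h : Word w} {p : Prog w c O} {o : O}
    (ho : ret o ∈ (onSlot i h p).residuals) : ret o ∈ p.residuals := by
  have ret_states : (onSlot i h p).residuals ⊆ {x | ∀ o, x = ret o → ret o ∈ p.residuals} := by
    refine residuals_onSlot_subset i h p ?_
    rintro r hr b o' e
    cases r <;> cases b <;> simp only [slotState, onSlot, reduceCtorEq] at e
    all_goals exact Prog.ret.inj e ▸ hr
  exact ret_states ho o rfl

end Prog

/-! ### Loops over the slots -/

namespace Prog

variable {w c L : ℕ} {O O' : Type}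

/-- Read the headers of the slots in the list, updating the family `acc`, and pass the result to the
continuation `k`. -/
def readHdrs (k : (Fin L → Word w) → Prog w (numCells L c) O) :
    List (Fin L) → (Fin L → Word w) → Prog w (numCells L c) O
  | [], acc => k acc
  | i :: l, acc => read (hdr i) fun x => readHdrs k l (Function.update acc i x)

/-- Write the headers `h` of the slots in the list, and continue with `p`. -/
def writeHdrs (h : Fin L → Word w) (p : Prog w (numCells L c) O) :
    List (Fin L) → Prog w (numCells L c) O
  | [] => p
  | i :: l => write (hdr i) (h i) (writeHdrs h p l)

/-- Simulate `p` on the slots in the list, updating the family `acc` by the returned values, and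
pass the result to the continuation `k`. -/
def runSlots (p : Prog w c O) (h : Fin L → Word w) (k : (Fin L → O) → Prog w (numCells L c) O') :
    List (Fin L) → (Fin L → O) → Prog w (numCells L c) O'
  | [], acc => k acc
  | i :: l, acc => (onSlot i (h i) p).bind fun o => runSlots p h k l (Function.update acc i o)

theorem wp_readHdrs (k : (Fin L → Word w) → Prog w (numCells L c) O)
    (Φ : O × Mem w (numCells L c) → ℝ≥0∞) (M : Mem w (numCells L c)) (l : List (Fin L))
    (acc : Fin L → Word w) (hacc : ∀ i, i ∉ l → acc i = M (hdr i)) :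
    (readHdrs k l acc).wp Φ M = (k fun i => M (hdr i)).wp Φ M := by
  induction l generalizing acc with
  | nil => rw [readHdrs, funext fun i => hacc i List.not_mem_nil]
  | cons i l ih =>
    rw [readHdrs, wp]
    refine ih _ fun i' hi' => ?_
    obtain rfl | hne := eq_or_ne i' i
    · exact Function.update_self ..
    · rw [Function.update_of_ne hne]
      exact hacc i' (by simp [hne, hi'])

theorem wp_writeHdrs_le (h : Fin L → Word w) (p : Prog w (numCells L c) O)
    (Φ : O × Mem w (numCells L c) → ℝ≥0∞) (C : ℝ≥0∞) (M : Mem w (numCells L c))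
    (l : List (Fin L))
    (hp : ∀ M', (∀ i ∈ l, M' (hdr i) = h i) → (∀ x, (∀ i ∈ l, x ≠ hdr i) → M' x = M x) →
      p.wp Φ M' ≤ C) :
    (writeHdrs h p l).wp Φ M ≤ C := by
  induction l generalizing M with
  | nil => exact hp M (by simp) (by simp)
  | cons i l ih =>
    rw [writeHdrs, wp]
    refine ih _ fun M' written unchanged => hp M' ?_ ?_
    · rintro i' hi'
      by_cases hl : i' ∈ l
      · exact written i' hl
      · obtain rfl : i' = i := by simpa [hl] using hi'
        rw [unchanged _ fun j hj hij => hl ?_, Function.update_self]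
        obtain rfl : i' = j := by simpa [hdr] using hij
        exact hj
    · intro x hx
      rw [unchanged x fun j hj => hx j (.tail i hj), Function.update_of_ne (hx i (.head l))]

/-- The part of the effect of simulating programs on all the slots that does not depend on the
programs; `h` are the headers, `M₀` is the memory before the simulation and `M` the memory after
it. -/
structure Frames (h : Fin L → Word w) (M₀ M : Mem w (numCells L c)) : Prop where
  clk_eq : M clk = M₀ clk
  stamp_or : ∀ i j, M (stamp i j) = M₀ (stamp i j) ∨ M (stamp i j) = h i

theorem Frames.trans_frame {h : Fin L → Word w} {M₀ M M' : Mem w (numCells L c)} {i : Fin L}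
    (hM : Frames h M₀ M) (hF : Frame i (h i) M M') : Frames h M₀ M' where
  clk_eq := hF.clk_eq.trans hM.clk_eq
  stamp_or i' j := by
    obtain rfl | hne := eq_or_ne i' i
    · exact (hF.stamp_or j).elim (fun e => e ▸ hM.stamp_or i' j) .inr
    · rw [hF.stamp_eq i' hne j]
      exact hM.stamp_or i' j

theorem wp_runSlots_le (p : Prog w c O) (h : Fin L → Word w)
    (k : (Fin L → O) → Prog w (numCells L c) O') (Φ : O' × Mem w (numCells L c) → ℝ≥0∞)
    (g : Fin L → O × Mem w c → ℝ≥0∞) (C : ℝ≥0∞) (M₀ : Mem w (numCells L c))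
    (hk : ∀ acc M, Frames h M₀ M → (k acc).wp Φ M ≤ ∑ i, g i (acc i, view M i (h i)) + C)
    (l : List (Fin L)) (hl : l.Nodup) (acc : Fin L → O) (M : Mem w (numCells L c))
    (hM : Frames h M₀ M) :
    (runSlots p h k l acc).wp Φ M
      ≤ ∑ i, (if i ∈ l then p.wp (g i) (view M i (h i)) else g i (acc i, view M i (h i))) + C := by
  induction l generalizing acc M with
  | nil => simpa [runSlots] using hk acc M hM
  | cons i l ih =>
    obtain ⟨hil, hl⟩ := List.nodup_cons.1 hl
    set rest : ℝ≥0∞ := ∑ i' ∈ Finset.univ.erase i,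
      (if i' ∈ i :: l then p.wp (g i') (view M i' (h i')) else g i' (acc i', view M i' (h i')))
      with hrest
    have run_rest (o : O) (M' : Mem w (numCells L c)) (hM' : Frame i (h i) M M') :
        (runSlots p h k l (Function.update acc i o)).wp Φ M'
          ≤ g i (o, view M' i (h i)) + (rest + C) := by
      refine (ih hl _ M' (hM.trans_frame hM')).trans_eq ?_
      rw [← Finset.add_sum_erase _ _ (Finset.mem_univ i), if_neg hil, Function.update_self,
        add_assoc, hrest]
      congr 2
      refine Finset.sum_congr rfl fun i' hi' => ?_
      have hne : i' ≠ i := Finset.ne_of_mem_erase hi'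
      simp only [List.mem_cons, hne, false_or, Function.update_of_ne hne, hM'.view_eq hne]
    rw [runSlots, wp_bind]
    refine (wp_onSlot_le i (h i) p _ (fun y => g i y + (rest + C)) M run_rest).trans_eq ?_
    rw [wp_add, wp_const, ← Finset.add_sum_erase _ _ (Finset.mem_univ i), ← hrest,
      if_pos List.mem_cons_self, add_assoc]

theorem cost_readHdrs_le (k : (Fin L → Word w) → Prog w (numCells L c) O) {C : ℕ}
    (hk : ∀ acc, (k acc).cost ≤ C) (l : List (Fin L)) (acc : Fin L → Word w) :
    (readHdrs k l acc).cost ≤ l.length + C := by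
  induction l generalizing acc with
  | nil => simpa [readHdrs] using hk acc
  | cons i l ih =>
    have next_le : (readHdrs k (i :: l) acc).cost ≤ 1 + (l.length + C) :=
      Nat.add_le_add_left (Finset.sup_le fun x _ => ih _) 1
    rw [List.length_cons]
    omega

theorem cost_writeHdrs (h : Fin L → Word w) (p : Prog w (numCells L c) O) (l : List (Fin L)) :
    (writeHdrs h p l).cost = l.length + p.cost := by
  induction l with
  | nil => simp [writeHdrs]
  | cons i l ih => simp only [writeHdrs, cost, ih, List.length_cons]; omega

theorem cost_runSlots_le (p : Prog w c O) (h : Fin L → Word w)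
    (k : (Fin L → O) → Prog w (numCells L c) O') {C : ℕ} (hk : ∀ acc, (k acc).cost ≤ C)
    (l : List (Fin L)) (acc : Fin L → O) :
    (runSlots p h k l acc).cost ≤ l.length * (2 * p.cost) + C := by
  induction l generalizing acc with
  | nil => simpa [runSlots] using hk acc
  | cons i l ih =>
    calc (runSlots p h k (i :: l) acc).cost
        ≤ (onSlot i (h i) p).cost + (l.length * (2 * p.cost) + C) :=
          cost_bind_le _ _ fun o => ih _
      _ ≤ 2 * p.cost + (l.length * (2 * p.cost) + C) := by
          gcongr
          exact cost_onSlot_le i (h i) p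
      _ = (i :: l).length * (2 * p.cost) + C := by rw [List.length_cons]; ring

theorem residuals_readHdrs_subset (k : (Fin L → Word w) → Prog w (numCells L c) O)
    {T : Set (Prog w (numCells L c) O)} (l : List (Fin L))
    (hT : ∀ l', l' <:+ l → ∀ acc, readHdrs k l' acc ∈ T) (hk : ∀ acc, (k acc).residuals ⊆ T)
    (acc : Fin L → Word w) : (readHdrs k l acc).residuals ⊆ T := by
  induction l generalizing acc with
  | nil => exact hk acc
  | cons i l ih =>
    exact Set.insert_subset (hT _ List.suffix_rfl acc) <| Set.iUnion_subset fun x =>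
      ih (fun l' hl' => hT l' (hl'.trans (List.suffix_cons i l))) _

theorem residuals_writeHdrs_subset (h : Fin L → Word w) (p : Prog w (numCells L c) O)
    {T : Set (Prog w (numCells L c) O)} (l : List (Fin L))
    (hT : ∀ l', l' <:+ l → writeHdrs h p l' ∈ T) (hp : p.residuals ⊆ T) :
    (writeHdrs h p l).residuals ⊆ T := by
  induction l with
  | nil => exact hp
  | cons i l ih =>
    exact Set.insert_subset (hT _ List.suffix_rfl) <|
      ih fun l' hl' => hT l' (hl'.trans (List.suffix_cons i l))

theorem residuals_runSlots_subset (p : Prog w c O) (h : Fin L → Word w)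
    (k : (Fin L → O) → Prog w (numCells L c) O') {T : Set (Prog w (numCells L c) O')} (V : Set O)
    (hV : ∀ o, ret o ∈ p.residuals → o ∈ V) (l : List (Fin L))
    (hT : ∀ i l', i :: l' <:+ l → ∀ acc : Fin L → O, (∀ i, acc i ∈ V) → ∀ r ∈ p.residuals, ∀ b,
      ((slotState i (h i) r b).bind fun o => runSlots p h k l' (Function.update acc i o)) ∈ T)
    (hk : ∀ acc : Fin L → O, (∀ i, acc i ∈ V) → (k acc).residuals ⊆ T)
    (acc : Fin L → O) (hacc : ∀ i, acc i ∈ V) : (runSlots p h k l acc).residuals ⊆ T := by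
  induction l generalizing acc with
  | nil => exact hk acc hacc
  | cons i l ih =>
    refine residuals_bind_subset _ _ (residuals_onSlot_subset i (h i) p
      (T := {r | (r.bind fun o => runSlots p h k l (Function.update acc i o)) ∈ T})
      (hT i l List.suffix_rfl acc hacc)) fun o ho => ?_
    refine ih (fun i' l' hl' => hT i' l' (hl'.trans (List.suffix_cons i l))) _ fun i' => ?_
    obtain rfl | hne := eq_or_ne i' i
    · simpa using hV o (ret_mem_residuals_of_onSlot ho)
    · simpa [Function.update_of_ne hne] using hacc i'

end Prog

/-! ### Time and space of the machine -/

/-- The decisions of a machine with `L` slots. At the beginning of an update `alloc` sets the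
headers, given the time and the old headers; at its end `prune` sets them, given the numbers
returned by the copies, and `res` is the output. -/
structure Policy (w L : ℕ) (O : Type) where
  alloc : Word w → (Fin L → Word w) → Fin L → Word w
  prune : (Fin L → Word w) → (Fin L → ℝ) → Fin L → Word w
  res : Word w → (Fin L → Word w) → (Fin L → ℝ) → O

/-- The control states of a streaming algorithm. -/
def StreamAlg.states {w : ℕ} {U O : Type} (A : StreamAlg w U O) : Set (Prog w A.cells O) :=
  ⋃ u, (A.step u).residuals

theorem logb_two_natCast_nonneg (n : ℕ) : 0 ≤ Real.logb 2 n :=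
  div_nonneg (Real.log_natCast_nonneg n) (Real.log_nonneg one_le_two)

namespace Policy

open Prog

variable {w c L : ℕ} {O U : Type} (P : Policy w L O)

/-- The last phase of an update at time `x`, after which the headers `h` are pruned. -/
def finish (c : ℕ) (x : Word w) (h : Fin L → Word w) (l : List (Fin L)) (o : Fin L → ℝ) :
    Prog w (numCells L c) O :=
  writeHdrs (P.prune h o) (ret (P.res x h o)) l

/-- The phase of an update in which the copies execute `p`. -/
def simulate (p : Prog w c ℝ) (x : Word w) (h : Fin L → Word w) (l : List (Fin L))
    (acc : Fin L → ℝ) : Prog w (numCells L c) O :=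
  runSlots p h (P.finish c x h (List.finRange L)) l acc

/-- The phase of an update that begins with reading the headers. -/
def load (p : Prog w c ℝ) (x : Word w) (l : List (Fin L)) (acc : Fin L → Word w) :
    Prog w (numCells L c) O :=
  readHdrs (fun h => P.simulate p x (P.alloc x h) (List.finRange L) 0) l acc

/-- The program of the machine for an update on which the copies execute `p`. -/
def update (p : Prog w c ℝ) : Prog w (numCells L c) O :=
  read clk fun x => write clk (succWord x)
    (P.load p (succWord x) (List.finRange L) fun _ => zeroWord w)

/-- The streaming algorithm that runs copies of `A` on the slots. -/
def alg (A : StreamAlg w U ℝ) : StreamAlg w U O where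
  cells := numCells L A.cells
  step u := P.update (A.step u)

theorem cost_update_le (p : Prog w c ℝ) :
    (P.update p).cost ≤ 2 + 2 * L + L * (2 * p.cost) := by
  have simulate_le (x h acc) : (P.simulate p x h (List.finRange L) acc).cost
      ≤ L * (2 * p.cost) + L := by
    refine (cost_runSlots_le p h _ (C := L) (fun o => ?_) _ acc).trans (by simp)
    simp [finish, cost_writeHdrs, cost]
  have load_le (x acc) : (P.load p x (List.finRange L) acc).cost ≤ L + (L * (2 * p.cost) + L) :=
    (cost_readHdrs_le _ (fun h => simulate_le _ _ _) _ acc).trans (by simp)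
  have update_le : (P.update p).cost ≤ 1 + (1 + (L + (L * (2 * p.cost) + L))) :=
    Nat.add_le_add_left (Finset.sup_le fun x _ => Nat.add_le_add_left (load_le _ _) 1) 1
  omega

theorem updateTimeLE_alg (A : StreamAlg w U ℝ) {t : ℝ} (hA : A.UpdateTimeLE t) :
    (P.alg A).UpdateTimeLE ((4 * L + 3) * t) := by
  intro u
  have cost_le : (((P.alg A).step u).cost : ℝ) ≤ 2 + 2 * L + L * (2 * (A.step u).cost) :=
    mod_cast P.cost_update_le (A.step u)
  have hu := hA u
  push_cast at hu ⊢
  nlinarith [mul_le_mul_of_nonneg_left hu (Nat.cast_nonneg (α := ℝ) L),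
    Nat.cast_nonneg (α := ℝ) (A.step u).cost]

theorem exists_drop_of_suffix {l : List (Fin L)} (hl : l <:+ List.finRange L) :
    ∃ j : Fin (L + 1), (List.finRange L).drop j = l :=
  ⟨⟨L - l.length, by omega⟩, by simpa using (List.suffix_iff_eq_drop.1 hl).symm⟩

section states

variable (Q : Set (Prog w c ℝ))

/-- The numbers that the machine handles if the control states of its copies belong to `Q`: the
values returned by the copies, and the number `0` with which it initializes them. -/
def returnValues : Set ℝ := insert 0 {o | ret o ∈ Q}

/-- An index set for the control states of the machine: the phase, the program of the update, the
control state of a simulated copy and the flag of `Prog.slotState`, the time, the headers, the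
number of slots that the current loop has dealt with, and the returned values. -/
abbrev Control (w L : ℕ) {c : ℕ} (Q : Set (Prog w c ℝ)) : Type :=
  Fin 5 × Q × Q × Bool × Word w × (Fin L → Word w) × Fin (L + 1) × (Fin L → returnValues Q)

/-- The control state with a given index. -/
def control : Control w L Q → Prog w (numCells L c) O
  | (0, p, _, _, _, _, _, _) => P.update p.1
  | (1, p, _, _, x, _, _, _) => write clk x (P.load p.1 x (List.finRange L) fun _ => zeroWord w)
  | (2, p, _, _, x, h, j, _) => P.load p.1 x ((List.finRange L).drop j) h
  | (3, p, r, b, x, h, j, o) =>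
    match (List.finRange L).drop j with
    | [] => P.update p.1
    | i :: l => (slotState i (h i) r.1 b).bind fun v =>
        P.simulate p.1 x h l (Function.update (fun i => (o i : ℝ)) i v)
  | (4, _, _, _, x, h, j, o) => P.finish c x h ((List.finRange L).drop j) fun i => (o i : ℝ)

variable {Q} {p : Prog w c ℝ}

theorem finish_mem_range_control (hp : p ∈ Q) (x : Word w) (h : Fin L → Word w)
    {l : List (Fin L)} (hl : l <:+ List.finRange L) {o : Fin L → ℝ}
    (ho : ∀ i, o i ∈ returnValues Q) : P.finish c x h l o ∈ Set.range (P.control Q) := by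
  obtain ⟨j, rfl⟩ := exists_drop_of_suffix hl
  exact ⟨(4, ⟨p, hp⟩, ⟨p, hp⟩, true, x, h, j, fun i => ⟨o i, ho i⟩), rfl⟩

theorem residuals_simulate_subset (hp : p.residuals ⊆ Q) (x : Word w) (h : Fin L → Word w) :
    (P.simulate p x h (List.finRange L) 0).residuals ⊆ Set.range (P.control Q) := by
  have hpQ : p ∈ Q := hp (mem_residuals_self p)
  refine residuals_runSlots_subset p h _ (returnValues Q) (fun o ho => .inr (hp ho)) _ ?_ ?_ _
    fun _ => Set.mem_insert _ _
  · intro i l hl acc hacc r hr b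
    obtain ⟨j, hj⟩ := exists_drop_of_suffix hl
    refine ⟨(3, ⟨p, hpQ⟩, ⟨r, hp hr⟩, b, x, h, j, fun i => ⟨acc i, hacc i⟩), ?_⟩
    simp only [control, hj]
    rfl
  · intro acc hacc
    refine residuals_writeHdrs_subset _ _ _
      (fun l hl => P.finish_mem_range_control hpQ x h hl hacc) ?_
    exact Set.singleton_subset_iff.2 (P.finish_mem_range_control hpQ x h List.nil_suffix hacc)

theorem residuals_update_subset (hp : p.residuals ⊆ Q) :
    (P.update p).residuals ⊆ Set.range (P.control Q) := by
  have hpQ : p ∈ Q := hp (mem_residuals_self p)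
  let o₀ : Fin L → returnValues Q := fun _ => ⟨0, Set.mem_insert _ _⟩
  let h₀ : Fin L → Word w := fun _ => zeroWord w
  have load_subset (x) : (P.load p x (List.finRange L) h₀).residuals
      ⊆ Set.range (P.control Q) := by
    refine residuals_readHdrs_subset _ _ (fun l hl acc => ?_)
      (fun acc => P.residuals_simulate_subset hp _ _) _
    obtain ⟨j, rfl⟩ := exists_drop_of_suffix hl
    exact ⟨(2, ⟨p, hpQ⟩, ⟨p, hpQ⟩, true, x, acc, j, o₀), rfl⟩
  exact Set.insert_subset ⟨(0, ⟨p, hpQ⟩, ⟨p, hpQ⟩, true, zeroWord w, h₀, 0, o₀), rfl⟩ <|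
    Set.iUnion_subset fun x => Set.insert_subset
      ⟨(1, ⟨p, hpQ⟩, ⟨p, hpQ⟩, true, succWord x, h₀, 0, o₀), rfl⟩ (load_subset _)

theorem ncard_returnValues_le (hQ : Q.Finite) : (returnValues Q).ncard ≤ Q.ncard + 1 := by
  refine (Set.ncard_insert_le _ _).trans (Nat.add_le_add_right ?_ 1)
  exact Set.ncard_le_ncard_of_injOn (fun o => ret o) (fun _ ho => ho)
    (fun _ _ _ _ e => Prog.ret.inj e) hQ

theorem finite_returnValues (hQ : Q.Finite) : (returnValues Q).Finite :=
  (hQ.preimage fun _ _ _ _ e => Prog.ret.inj e).insert 0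

theorem card_control_le (hQ : Q.Finite) :
    Nat.card (Control w L Q) ≤ 2 ^ (4 + w + w * L + 2 * L) * Q.ncard ^ (L + 2) := by
  calc Nat.card (Control w L Q)
      = 10 * Q.ncard ^ 2 * 2 ^ w * (2 ^ w) ^ L * (L + 1) * (returnValues Q).ncard ^ L := by
        simp only [Control, Nat.card_prod, Nat.card_fun, Nat.card_fin, Nat.card_coe_set_eq,
          Nat.card_eq_fintype_card (α := Bool), Fintype.card_bool]
        ring
    _ ≤ 16 * Q.ncard ^ 2 * 2 ^ w * (2 ^ w) ^ L * 2 ^ L * (Q.ncard + 1) ^ L := by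
        gcongr
        · norm_num
        · exact Nat.lt_two_pow_self
        · exact ncard_returnValues_le hQ
    _ ≤ 16 * Q.ncard ^ 2 * 2 ^ w * (2 ^ w) ^ L * 2 ^ L * (2 * Q.ncard) ^ L := by
        rcases Nat.eq_zero_or_pos Q.ncard with h0 | h0
        · simp [h0]
        · gcongr
          omega
    _ = 2 ^ (4 + w + w * L + 2 * L) * Q.ncard ^ (L + 2) := by
        rw [← pow_mul]
        ring

end states

variable [Finite U] (A : StreamAlg w U ℝ)

theorem ncard_states_alg_le :
    (P.alg A).states.ncard ≤ 2 ^ (4 + w + w * L + 2 * L) * A.states.ncard ^ (L + 2) := by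
  have hQ : A.states.Finite := Set.finite_iUnion fun u => finite_residuals _
  have : Finite A.states := hQ
  have : Finite (returnValues A.states) := finite_returnValues hQ
  have states_subset : (P.alg A).states ⊆ Set.range (P.control A.states) :=
    Set.iUnion_subset fun u => P.residuals_update_subset
      (Set.subset_iUnion (fun u => (A.step u).residuals) u)
  calc (P.alg A).states.ncard
      ≤ (Set.range (P.control A.states)).ncard :=
        Set.ncard_le_ncard states_subset (Set.finite_range _)
    _ ≤ Nat.card (Control w L A.states) := Finite.card_range_le _
    _ ≤ _ := card_control_le hQ

theorem logb_ncard_states_alg_le :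
    Real.logb 2 (P.alg A).states.ncard
      ≤ 4 + w + w * L + 2 * L + (L + 2) * Real.logb 2 A.states.ncard := by
  have ncard_le := P.ncard_states_alg_le A
  rcases Nat.eq_zero_or_pos (P.alg A).states.ncard with h0 | h0
  · have := logb_two_natCast_nonneg A.states.ncard
    rw [h0, Nat.cast_zero, Real.logb_zero]
    positivity
  · have hR : (A.states.ncard : ℝ) ^ (L + 2) ≠ 0 :=
      mod_cast (Nat.pos_of_mul_pos_left (h0.trans_le ncard_le)).ne'
    calc Real.logb 2 (P.alg A).states.ncard
        ≤ Real.logb 2 (2 ^ (4 + w + w * L + 2 * L) * (A.states.ncard : ℝ) ^ (L + 2)) :=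
          Real.logb_le_logb_of_le one_lt_two (mod_cast h0) (mod_cast ncard_le)
      _ = _ := by
          rw [Real.logb_mul (by positivity) hR, Real.logb_pow, Real.logb_pow,
            Real.logb_self_eq_one one_lt_two]
          push_cast
          ring

theorem spaceBits_alg_le :
    (P.alg A).spaceBits ≤ (4 * L + 2) * A.spaceBits + (2 * L + 2) * w + 3 * L + 4 := by
  have cells_eq : ((P.alg A).cells : ℝ) = 1 + L + 2 * L * A.cells := by
    simp only [alg, numCells, Loc, Fintype.card_sum, Fintype.card_prod, Fintype.card_fin,
      Fintype.card_unit]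
    push_cast
    ring
  have states_le := P.logb_ncard_states_alg_le A
  have hR := logb_two_natCast_nonneg A.states.ncard
  have hL : (0 : ℝ) ≤ L := Nat.cast_nonneg L
  have hcells : 0 ≤ (A.cells : ℝ) * w := by positivity
  calc (P.alg A).spaceBits
      = (1 + L + 2 * L * A.cells) * w + Real.logb 2 (P.alg A).states.ncard := by
        rw [StreamAlg.spaceBits, cells_eq, StreamAlg.states]
    _ ≤ (4 * L + 2) * (A.cells * w + Real.logb 2 A.states.ncard)
          + (2 * L + 2) * w + 3 * L + 4 := by
        nlinarith [mul_nonneg hL hR, mul_nonneg hL hcells]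
    _ = _ := rfl

end Policy

/-! ### Pruning a family of estimates -/

section prune

variable {ι τ : Type*} [LinearOrder τ] {θ : ℝ} {t : ι → τ} {v : ι → ℝ}

theorem exists_le_pow_mul (hθ : 0 ≤ θ) (N : ℕ) (s : Finset ι) (hinj : Set.InjOn t s)
    (hs : ∀ i ∈ s, ∀ j ∈ s, ∀ k ∈ s, t i < t j → t j < t k → v k ≤ θ * v i)
    (hN : 2 * N + 1 ≤ s.card) (i : ι) (hi : i ∈ s) (hmin : ∀ j ∈ s, t i ≤ t j) :
    ∃ k ∈ s, v k ≤ θ ^ N * v i := by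
  classical
  induction N generalizing s i with
  | zero => exact ⟨i, hi, by simp⟩
  | succ N ih =>
    have card_i : (s.erase i).card = s.card - 1 := Finset.card_erase_of_mem hi
    obtain ⟨j, hj, hjmin⟩ := (s.erase i).exists_min_image t (Finset.card_pos.1 (by omega))
    have card_ij : ((s.erase i).erase j).card = s.card - 1 - 1 := by
      rw [Finset.card_erase_of_mem hj, card_i]
    obtain ⟨k, hk, hkmin⟩ := ((s.erase i).erase j).exists_min_image t
      (Finset.card_pos.1 (by omega))
    have hsub : (s.erase i).erase j ⊆ s :=
      (Finset.erase_subset _ _).trans (Finset.erase_subset _ _)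
    have hjs : j ∈ s := Finset.mem_of_mem_erase hj
    obtain ⟨l, hl, hle⟩ := ih ((s.erase i).erase j) (hinj.mono (Finset.coe_subset.2 hsub))
      (fun a ha b hb c hc => hs a (hsub ha) b (hsub hb) c (hsub hc)) (by omega) k hk hkmin
    have hij : t i < t j := (hmin j hjs).lt_of_ne fun e =>
      Finset.ne_of_mem_erase hj (hinj hi hjs e).symm
    have hjk : t j < t k := (hjmin k (Finset.mem_of_mem_erase hk)).lt_of_ne fun e =>
      Finset.ne_of_mem_erase hk (hinj hjs (hsub hk) e).symm
    refine ⟨l, hsub hl, hle.trans ?_⟩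
    rw [pow_succ, mul_assoc]
    exact mul_le_mul_of_nonneg_left (hs i hi j hjs k (hsub hk) hij hjk) (pow_nonneg hθ N)

variable [DecidableEq ι] {s s' : Finset ι}

/-- One step of pruning: `s'` arises from `s` by removing an index `j` that lies, in the order given
by `t`, between two others `i` and `k` whose values differ by a factor of at most `θ`. -/
def Removal (θ : ℝ) (t : ι → τ) (v : ι → ℝ) (s s' : Finset ι) : Prop :=
  ∃ j ∈ s, s' = s.erase j ∧ ∃ i ∈ s', ∃ k ∈ s', t i < t j ∧ t j < t k ∧ θ * v i ≤ v k

theorem exists_pruned (θ : ℝ) (t : ι → τ) (v : ι → ℝ) (s : Finset ι) :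
    ∃ s', Relation.ReflTransGen (Removal θ t v) s s' ∧ ∀ s'', ¬ Removal θ t v s' s'' := by
  induction s using Finset.strongInduction with
  | H s ih =>
    by_cases h : ∃ s'', Removal θ t v s s''
    · obtain ⟨_, j, hj, rfl, hr⟩ := h
      obtain ⟨s', reach, stuck⟩ := ih _ (Finset.erase_ssubset hj)
      exact ⟨s', reach.head ⟨j, hj, rfl, hr⟩, stuck⟩
    · exact ⟨s, .refl, fun s'' hs => h ⟨s'', hs⟩⟩

/-- The result of removing indices from `s`, in some order, as long as possible. -/
def pruned (θ : ℝ) (t : ι → τ) (v : ι → ℝ) (s : Finset ι) : Finset ι :=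
  (exists_pruned θ t v s).choose

theorem reflTransGen_removal_pruned (θ : ℝ) (t : ι → τ) (v : ι → ℝ) (s : Finset ι) :
    Relation.ReflTransGen (Removal θ t v) s (pruned θ t v s) :=
  (exists_pruned θ t v s).choose_spec.1

theorem not_removal_pruned (θ : ℝ) (t : ι → τ) (v : ι → ℝ) (s s' : Finset ι) :
    ¬ Removal θ t v (pruned θ t v s) s' :=
  (exists_pruned θ t v s).choose_spec.2 s'

theorem subset_of_reflTransGen_removal (h : Relation.ReflTransGen (Removal θ t v) s s') :
    s' ⊆ s := by
  induction h with
  | refl => exact subset_rfl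
  | tail _ h ih =>
    obtain ⟨j, -, rfl, -⟩ := h
    exact (Finset.erase_subset _ _).trans ih

theorem pruned_subset (θ : ℝ) (t : ι → τ) (v : ι → ℝ) (s : Finset ι) : pruned θ t v s ⊆ s :=
  subset_of_reflTransGen_removal (reflTransGen_removal_pruned θ t v s)

theorem card_le_of_not_removal {lo hi : ℝ} (hθ : 0 ≤ θ) {N : ℕ} (hinj : Set.InjOn t s)
    (hs : ∀ s', ¬ Removal θ t v s s') (hlo : ∀ i ∈ s, lo ≤ v i) (hhi : ∀ i ∈ s, v i ≤ hi)
    (hN : θ ^ N * hi < lo) : s.card ≤ 2 * N := by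
  by_contra! hc
  have decrease : ∀ i ∈ s, ∀ j ∈ s, ∀ k ∈ s, t i < t j → t j < t k → v k ≤ θ * v i := by
    intro i hi j hj k hk hij hjk
    by_contra! hlt
    exact hs _ ⟨j, hj, rfl, i, Finset.mem_erase.2 ⟨ne_of_apply_ne t hij.ne, hi⟩, k,
      Finset.mem_erase.2 ⟨ne_of_apply_ne t hjk.ne', hk⟩, hij, hjk, hlt.le⟩
  obtain ⟨i, hi, hmin⟩ := s.exists_min_image t (Finset.card_pos.1 (by omega))
  obtain ⟨k, hk, hle⟩ := exists_le_pow_mul hθ N s hinj decrease hc i hi hmin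
  have := mul_le_mul_of_nonneg_left (hhi i hi) (pow_nonneg hθ N)
  linarith [hlo k hk]

end prune

/-! ### Smooth histograms -/

/-- `v` approximates `x` with relative error at most `a`. -/
def RelApprox (a x v : ℝ) : Prop := (1 - a) * x ≤ v ∧ v ≤ (1 + a) * x

theorem RelApprox.one_sub_mul_le {a β F G x y : ℝ} (hx : RelApprox a F x) (hy : RelApprox a G y)
    (hxy : (1 - β / 2) * x ≤ y) (hF : 0 ≤ F) (ha : 0 ≤ a) (haβ : 4 * a ≤ β) (hβ : β ≤ 1) :
    (1 - β) * F ≤ G := by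
  have estimates : (1 - β / 2) * ((1 - a) * F) ≤ (1 + a) * G :=
    (mul_le_mul_of_nonneg_left hx.1 (by linarith)).trans (hxy.trans hy.2)
  have factors : (1 + a) * (1 - β) ≤ (1 - β / 2) * (1 - a) := by nlinarith
  refine le_of_mul_le_mul_left ?_ (show 0 < 1 + a by linarith)
  linarith [mul_le_mul_of_nonneg_right factors hF]

theorem RelApprox.of_sandwich {a ρ F G v : ℝ} (hv : RelApprox a F v) (hGF : G ≤ F)
    (hFG : (1 - ρ) * F ≤ G) (hG : 0 ≤ G) (ha : 0 ≤ a) (haρ : 4 * a ≤ ρ) (hρ : ρ ≤ 1 / 4) :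
    RelApprox (2 * ρ) G v := by
  refine ⟨by nlinarith [hv.1], hv.2.trans ?_⟩
  have factors : 1 + a ≤ (1 - ρ) * (1 + 2 * ρ) := by nlinarith
  refine le_of_mul_le_mul_left ?_ (show 0 < 1 - ρ by linarith)
  nlinarith [mul_le_mul_of_nonneg_right factors hG]

section smooth

variable {U ι : Type*} {f : List U → ℝ} {β : ℝ} {σ : List U}

/-- The starting position `t` covers the position `p` of the stream: at some moment since the
arrival of `p`, the suffixes starting at `t` and `p` had almost the same value. -/
def CoversAt (f : List U → ℝ) (β : ℝ) (σ : List U) (t p : ℕ) : Prop :=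
  t ≤ p ∧ ∃ e, p < e ∧ e ≤ σ.length ∧
    (1 - β) * f ((σ.take e).drop t) ≤ f ((σ.take e).drop p)

/-- Every position of the stream is covered by one of the starting positions `t i`, `i ∈ s`. -/
def Covers (f : List U → ℝ) (β : ℝ) (σ : List U) (t : ι → ℕ) (s : Finset ι) : Prop :=
  ∀ p < σ.length, ∃ i ∈ s, CoversAt f β σ (t i) p

/-- The numbers `v i`, `i ∈ s`, approximate `f` on the suffixes that start at the positions
`t i`. -/
def Accurate (f : List U → ℝ) (a : ℝ) (σ : List U) (t : ι → ℕ) (v : ι → ℝ) (s : Finset ι) : Prop :=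
  ∀ i ∈ s, RelApprox a (f (σ.drop (t i))) (v i)

theorem CoversAt.append {t p : ℕ} (h : CoversAt f β σ t p) (u : U) :
    CoversAt f β (σ ++ [u]) t p := by
  obtain ⟨htp, e, hpe, he, hle⟩ := h
  refine ⟨htp, e, hpe, by rw [List.length_append]; omega, ?_⟩
  rwa [List.take_append_of_le_length he]

theorem drop_take_append_drop {s e : ℕ} (hs : s ≤ e) (he : e ≤ σ.length) :
    (σ.take e).drop s ++ σ.drop e = σ.drop s := by
  rw [← List.drop_append_of_le_length (by simp [hs, he]), List.take_append_drop]

end smooth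

section smooth

variable {U ι : Type} {f : List U → ℝ} {m n q : ℕ} {ρ β a : ℝ} {σ : List U}

theorem IsSmooth.drop_le (hf : IsSmooth f m n q ρ β) (hσ : σ.length ≤ m) {p p' : ℕ}
    (hpp : p ≤ p') (hp : p' < σ.length) : f (σ.drop p') ≤ f (σ.drop p) :=
  hf.mono _ _ (List.drop_eq_nil_iff.not.2 hp.not_ge) (List.drop_suffix_drop_left σ hpp)
    (by rw [List.length_drop]; omega)

theorem IsSmooth.one_le_drop (hf : IsSmooth f m n q ρ β) (hσ : σ.length ≤ m) {p : ℕ}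
    (hp : p < σ.length) : 1 ≤ f (σ.drop p) :=
  hf.one_le _ (List.drop_eq_nil_iff.not.2 hp.not_ge) (by rw [List.length_drop]; omega)

theorem IsSmooth.drop_le_pow (hf : IsSmooth f m n q ρ β) (hσ : σ.length ≤ m) {p : ℕ}
    (hp : p < σ.length) : f (σ.drop p) ≤ (n : ℝ) ^ q :=
  hf.bounded _ (List.drop_eq_nil_iff.not.2 hp.not_ge) (by rw [List.length_drop]; omega)

theorem IsSmooth.coversAt_self (hf : IsSmooth f m n q ρ β) (hσ : σ.length ≤ m) {p : ℕ}
    (hp : p < σ.length) : CoversAt f β σ p p := by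
  refine ⟨le_rfl, σ.length, hp, le_rfl, ?_⟩
  rw [List.take_length]
  nlinarith [hf.one_le_drop hσ hp, hf.pos]

theorem CoversAt.one_sub_mul_le (hf : IsSmooth f m n q ρ β) (hσ : σ.length ≤ m) {t p : ℕ}
    (h : CoversAt f β σ t p) : (1 - ρ) * f (σ.drop t) ≤ f (σ.drop p) := by
  obtain ⟨htp, e, hpe, he, hle⟩ := h
  have ht := drop_take_append_drop (htp.trans hpe.le) he
  rw [← ht, ← drop_take_append_drop hpe.le he]
  refine hf.smooth _ _ _ ?_ (List.drop_suffix_drop_left _ htp) ?_ hle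
  · rw [Ne, List.drop_eq_nil_iff, List.length_take]
    omega
  · rw [ht, List.length_drop]
    omega

theorem Covers.removal [DecidableEq ι] (hf : IsSmooth f m n q ρ β) (hβ : β ≤ 1) (ha : 0 ≤ a)
    (haβ : 4 * a ≤ β) (hσ : σ.length ≤ m) {t : ι → ℕ} {v : ι → ℝ} {s s' : Finset ι}
    (ht : ∀ i ∈ s, t i < σ.length) (hv : Accurate f a σ t v s) (hc : Covers f β σ t s)
    (h : Removal (1 - β / 2) t v s s') : Covers f β σ t s' := by
  obtain ⟨j, hj, rfl, i, hi, k, hk, hij, hjk, hle⟩ := h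
  have his := Finset.mem_of_mem_erase hi
  have hks := Finset.mem_of_mem_erase hk
  intro p hp
  obtain ⟨x, hx, hxp⟩ := hc p hp
  obtain rfl | hxj := eq_or_ne x j
  · obtain ⟨hjp, e, hpe, he, hcov⟩ := hxp
    rcases le_or_gt (t k) p with hkp | hpk
    · refine ⟨k, hk, hkp, e, hpe, he, le_trans ?_ hcov⟩
      have hlen : (σ.take e).length = e := List.length_take_of_le he
      have : f ((σ.take e).drop (t k)) ≤ f ((σ.take e).drop (t x)) :=
        hf.drop_le (by omega) hjk.le (by omega)
      exact mul_le_mul_of_nonneg_left this (by linarith)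
    · refine ⟨i, hi, by omega, σ.length, hp, le_rfl, ?_⟩
      rw [List.take_length]
      have values_le : (1 - β) * f (σ.drop (t i)) ≤ f (σ.drop (t k)) :=
        (hv i his).one_sub_mul_le (hv k hks) hle
          (zero_le_one.trans (hf.one_le_drop hσ (ht i his))) ha haβ hβ
      exact values_le.trans (hf.drop_le hσ hpk.le (ht k hks))
  · exact ⟨x, Finset.mem_erase.2 ⟨hxj, hx⟩, hxp⟩

theorem Covers.pruned [DecidableEq ι] (hf : IsSmooth f m n q ρ β) (hβ : β ≤ 1) (ha : 0 ≤ a)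
    (haβ : 4 * a ≤ β) (hσ : σ.length ≤ m) {t : ι → ℕ} {v : ι → ℝ} {s : Finset ι}
    (ht : ∀ i ∈ s, t i < σ.length) (hv : Accurate f a σ t v s) (hc : Covers f β σ t s) :
    Covers f β σ t (pruned (1 - β / 2) t v s) := by
  have reach := reflTransGen_removal_pruned (1 - β / 2) t v s
  generalize DPHist.pruned (1 - β / 2) t v s = s' at reach ⊢
  induction reach with
  | refl => exact hc
  | tail reach h ih =>
    have hsub := subset_of_reflTransGen_removal reach
    exact ih.removal hf hβ ha haβ hσ (fun i hi => ht i (hsub hi)) (fun i hi => hv i (hsub hi)) h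

theorem card_pruned_le [DecidableEq ι] (hf : IsSmooth f m n q ρ β) (hβ : β ≤ 1) (ha : a ≤ 1 / 2)
    (hσ : σ.length ≤ m) {t : ι → ℕ} {v : ι → ℝ} {s : Finset ι}
    (hinj : Set.InjOn t s) (ht : ∀ i ∈ s, t i < σ.length) (hv : Accurate f a σ t v s) {N : ℕ}
    (hN : (1 - β / 2) ^ N * (2 * (n : ℝ) ^ q) < 1 / 2) :
    (pruned (1 - β / 2) t v s).card ≤ 2 * N := by
  have hsub := pruned_subset (1 - β / 2) t v s
  refine card_le_of_not_removal (by linarith) (hinj.mono (Finset.coe_subset.2 hsub))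
    (not_removal_pruned _ t v s) (lo := 1 / 2) (hi := 2 * (n : ℝ) ^ q) (fun i hi => ?_)
    (fun i hi => ?_) hN
  · nlinarith [(hv i (hsub hi)).1, hf.one_le_drop hσ (ht i (hsub hi))]
  · nlinarith [(hv i (hsub hi)).2, hf.one_le_drop hσ (ht i (hsub hi)),
      hf.drop_le_pow hσ (ht i (hsub hi))]

theorem Covers.relApprox (hf : IsSmooth f m n q ρ β) (hρ : ρ ≤ 1 / 4) (ha : 0 ≤ a)
    (haβ : 4 * a ≤ β) (hσ : σ.length ≤ m) {t : ι → ℕ} {v : ι → ℝ} {s : Finset ι}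
    (hv : Accurate f a σ t v s) (hc : Covers f β σ t s)
    {p : ℕ} (hp : p < σ.length) {i : ι} (hi : i ∈ s) (hip : t i ≤ p)
    (hmax : ∀ j ∈ s, t j ≤ p → t j ≤ t i) :
    RelApprox (2 * ρ) (f (σ.drop p)) (v i) := by
  obtain ⟨j, hj, hjp⟩ := hc p hp
  have hij : f (σ.drop (t i)) ≤ f (σ.drop (t j)) :=
    hf.drop_le hσ (hmax j hj hjp.1) (hip.trans_lt hp)
  have hρ1 : 0 ≤ 1 - ρ := by linarith
  exact (hv i hi).of_sandwich (hf.drop_le hσ hip hp)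
    ((mul_le_mul_of_nonneg_left hij hρ1).trans (hjp.one_sub_mul_le hf hσ))
    (zero_le_one.trans (hf.one_le_drop hσ hp)) ha (haβ.trans hf.le) hρ

end smooth

/-! ### The failure probability of a streaming algorithm -/

namespace StreamAlg

variable {w : ℕ} {U O : Type}

theorem exec_append_singleton (A : StreamAlg w U O) (σ : List U) (u : U) :
    A.exec (σ ++ [u]) = (A.exec σ).bind fun x =>
      ((A.step u).run x.2).map fun y => (some y.1, y.2) := by
  simp [exec, List.foldl_append]

/-- The expectation of `φ` of the output after the remaining updates, as a function of the state
before them. -/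
def future (A : StreamAlg w U O) (φ : Option O → ℝ≥0∞) :
    List U → Option O × Mem w A.cells → ℝ≥0∞
  | [], x => φ x.1
  | u :: τ, x => (A.step u).wp (fun y => A.future φ τ (some y.1, y.2)) x.2

theorem future_le_one (A : StreamAlg w U O) {φ : Option O → ℝ≥0∞} (hφ : ∀ o, φ o ≤ 1)
    (τ : List U) (x : Option O × Mem w A.cells) : A.future φ τ x ≤ 1 := by
  induction τ generalizing x with
  | nil => exact hφ _
  | cons u τ ih => exact (Prog.wp_mono _ (fun y => ih _) _).trans (Prog.wp_const _ _ _).le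

theorem expect_outputLaw (A : StreamAlg w U O) (φ : Option O → ℝ≥0∞) (σ : List U) :
    expect (A.outputLaw σ) φ = A.future φ σ (none, zeroMem w A.cells) := by
  have expect_exec (σ τ : List U) :
      expect (A.exec (σ ++ τ)) (fun x => φ x.1) = expect (A.exec σ) (A.future φ τ) := by
    induction τ generalizing σ with
    | nil => simp only [List.append_nil]; rfl
    | cons u τ ih =>
      rw [List.append_cons, ih, exec_append_singleton, expect_bind]
      simp_rw [expect_map, Prog.expect_run]
      rfl
  rw [outputLaw, expect_map]
  exact (expect_exec [] σ).trans (expect_pure _ _)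

/-- The event that a number is not an approximation of `f η`. -/
def inaccurate (f : List U → ℝ) (a : ℝ) (η : List U) : Set ℝ := {o | RelApprox a (f η) o}ᶜ

/-- The expected number of inaccurate outputs during the remaining updates, when the updates `η`
have been processed. -/
def futureErrors (A : StreamAlg w U ℝ) (f : List U → ℝ) (a : ℝ) :
    List U → List U → Mem w A.cells → ℝ≥0∞
  | [], _, _ => 0
  | u :: τ, η, V => (A.step u).wp (fun y =>
      (inaccurate f a (η ++ [u])).indicator 1 y.1 + A.futureErrors f a τ (η ++ [u]) y.2) V

theorem expect_run_inaccurate_le (A : StreamAlg w U ℝ) {f : List U → ℝ} {m : ℕ} {a d : ℝ}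
    (hA : A.IsApprox f m a d) (hd : 0 ≤ d) (hd' : d ≤ 1) (η : List U) (u : U)
    (hm : η.length + 1 ≤ m) :
    expect (A.exec η) (fun x =>
      (A.step u).wp (fun y => (inaccurate f a (η ++ [u])).indicator 1 y.1) x.2)
      ≤ ENNReal.ofReal d := by
  set G : Set (Option ℝ) := {o | ∃ v, o = some v ∧ RelApprox a (f (η ++ [u])) v}
  have eq_compl : expect (A.exec η) (fun x =>
      (A.step u).wp (fun y => (inaccurate f a (η ++ [u])).indicator 1 y.1) x.2)
      = (A.outputLaw (η ++ [u])).toOuterMeasure Gᶜ := by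
    rw [← expect_indicator, outputLaw, expect_map, exec_append_singleton, expect_bind]
    simp_rw [expect_map, Prog.expect_run]
    have indicator_eq (y : ℝ) :
        Gᶜ.indicator (1 : Option ℝ → ℝ≥0∞) (some y)
          = (inaccurate f a (η ++ [u])).indicator 1 y := by
      by_cases hy : RelApprox a (f (η ++ [u])) y <;> simp [G, inaccurate, hy]
    simp_rw [indicator_eq]
  have good : ENNReal.ofReal (1 - d) ≤ (A.outputLaw (η ++ [u])).toOuterMeasure G :=
    hA (η ++ [u]) (by simp) (by simpa using hm)
  rw [eq_compl]
  refine (ENNReal.add_le_add_iff_left (ENNReal.ofReal_ne_top (r := 1 - d))).1 ?_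
  calc ENNReal.ofReal (1 - d) + (A.outputLaw (η ++ [u])).toOuterMeasure Gᶜ
      ≤ (A.outputLaw (η ++ [u])).toOuterMeasure G
          + (A.outputLaw (η ++ [u])).toOuterMeasure Gᶜ := by gcongr
    _ = ENNReal.ofReal (1 - d) + ENNReal.ofReal d := by
      rw [toOuterMeasure_add_compl, ← ENNReal.ofReal_add (by linarith) hd]
      simp

theorem expect_futureErrors_le (A : StreamAlg w U ℝ) {f : List U → ℝ} {m : ℕ} {a d : ℝ}
    (hA : A.IsApprox f m a d) (hd : 0 ≤ d) (hd' : d ≤ 1) (τ η : List U)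
    (hm : η.length + τ.length ≤ m) :
    expect (A.exec η) (fun x => A.futureErrors f a τ η x.2) ≤ τ.length * ENNReal.ofReal d := by
  induction τ generalizing η with
  | nil => simp [futureErrors, expect_const]
  | cons u τ ih =>
    rw [List.length_cons] at hm
    have later_le := ih (η ++ [u]) (by rw [List.length_append, List.length_singleton]; omega)
    rw [exec_append_singleton, expect_bind] at later_le
    simp_rw [expect_map, Prog.expect_run] at later_le
    have now_le := A.expect_run_inaccurate_le hA hd hd' η u (by omega)
    simp_rw [futureErrors, Prog.wp_add, expect_add]
    refine (add_le_add now_le later_le).trans (le_of_eq ?_)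
    rw [List.length_cons]
    push_cast
    ring

/-- The expected number of inaccurate outputs of copies that are started at each of the updates. -/
def birthErrors (A : StreamAlg w U ℝ) (f : List U → ℝ) (a : ℝ) : List U → ℝ≥0∞
  | [] => 0
  | u :: τ => A.futureErrors f a (u :: τ) [] (zeroMem w A.cells) + A.birthErrors f a τ

theorem birthErrors_le (A : StreamAlg w U ℝ) {f : List U → ℝ} {m : ℕ} {a d : ℝ}
    (hA : A.IsApprox f m a d) (hd : 0 ≤ d) (hd' : d ≤ 1) (τ : List U) (hm : τ.length ≤ m) :
    A.birthErrors f a τ ≤ τ.length * m * ENNReal.ofReal d := by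
  induction τ with
  | nil => simp [birthErrors]
  | cons u τ ih =>
    have first_le := A.expect_futureErrors_le hA hd hd' (u :: τ) [] (by simpa using hm)
    simp only [exec, List.foldl_nil, expect_pure] at first_le
    have later_le := ih ((Nat.le_succ _).trans hm)
    calc A.birthErrors f a (u :: τ)
        ≤ m * ENNReal.ofReal d + τ.length * m * ENNReal.ofReal d := by
          refine add_le_add (first_le.trans ?_) later_le
          gcongr
      _ = (u :: τ).length * m * ENNReal.ofReal d := by
          rw [List.length_cons]
          push_cast
          ring

end StreamAlg

/-! ### The histogram policy -/

section histogram

variable {w L : ℕ}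

/-- The slots that are not free: the header `0` marks a free slot. -/
def alive (h : Fin L → Word w) : Finset (Fin L) := Finset.univ.filter fun i => (h i : ℕ) ≠ 0

/-- The position in the stream at which the copy in a slot has been started, given that the header
of an occupied slot is the time of this start. -/
def startPos (h : Fin L → Word w) (i : Fin L) : ℕ := (h i : ℕ) - 1

/-- The slot `i` holds the last copy that has been started at `p` or before. -/
def IsLast (h : Fin L → Word w) (p : ℕ) (i : Fin L) : Prop :=
  i ∈ alive h ∧ startPos h i ≤ p ∧
    ∀ j ∈ alive h, startPos h j ≤ p → startPos h j ≤ startPos h i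

open Classical in
/-- Start a copy at every update, prune the histogram, and answer with the value of the last copy
started before the window. -/
def histPolicy (w L : ℕ) (θ : ℝ) (W : ℕ) (scale : ℝ → ℝ≥0) : Policy w L (ℝ × ℝ≥0) where
  alloc x h := if e : ∃ i, (h i : ℕ) = 0 then Function.update h e.choose x else h
  prune h v i := if i ∈ pruned θ (startPos h) v (alive h) then h i else zeroWord w
  res x h v := if e : ∃ i, IsLast h (x - W) i then (v e.choose, scale (v e.choose)) else (0, 0)

variable {θ : ℝ} {W : ℕ} {scale : ℝ → ℝ≥0} {h h' : Fin L → Word w} {v : Fin L → ℝ} {i : Fin L}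

theorem mem_alive : i ∈ alive h ↔ (h i : ℕ) ≠ 0 := by
  simp [alive]

theorem startPos_congr (hi : h' i = h i) : startPos h' i = startPos h i := by
  rw [startPos, hi, startPos]

theorem alive_update {x : Word w} (hx : (x : ℕ) ≠ 0) :
    alive (Function.update h i x) = insert i (alive h) := by
  ext j
  rw [Finset.mem_insert, mem_alive, mem_alive]
  obtain rfl | hj := eq_or_ne j i
  · simpa using hx
  · simp [hj]

theorem alive_prune :
    alive ((histPolicy w L θ W scale).prune h v) = pruned θ (startPos h) v (alive h) := by
  ext i
  rw [mem_alive]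
  by_cases hi : i ∈ pruned θ (startPos h) v (alive h)
  · simpa [histPolicy, hi] using mem_alive.1 (pruned_subset _ _ _ _ hi)
  · simp [histPolicy, hi, zeroWord]

theorem prune_eq (hi : i ∈ pruned θ (startPos h) v (alive h)) :
    (histPolicy w L θ W scale).prune h v i = h i :=
  if_pos hi

theorem exists_isLast {p : ℕ} (hex : ∃ i ∈ alive h, startPos h i ≤ p) : ∃ i, IsLast h p i := by
  obtain ⟨i, hi, hmax⟩ := ((alive h).filter fun i => startPos h i ≤ p).exists_max_image (startPos h)
    (let ⟨i, hi⟩ := hex; ⟨i, Finset.mem_filter.2 hi⟩)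
  rw [Finset.mem_filter] at hi
  exact ⟨i, hi.1, hi.2, fun j hj hjp => hmax j (Finset.mem_filter.2 ⟨hj, hjp⟩)⟩

variable {U : Type} {f : List U → ℝ} {m n q : ℕ} {ρ β a : ℝ} {σ : List U}

/-- The headers describe a histogram of the stream `σ`. -/
structure IsHist (f : List U → ℝ) (β : ℝ) (σ : List U) (h : Fin L → Word w) : Prop where
  hdr_le : ∀ i, (h i : ℕ) ≤ σ.length
  inj : ∀ i ∈ alive h, ∀ j, h i = h j → i = j
  covers : Covers f β σ (startPos h) (alive h)

theorem IsHist.startPos_lt (hh : IsHist f β σ h) (hi : i ∈ alive h) : startPos h i < σ.length := by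
  have := hh.hdr_le i
  have := mem_alive.1 hi
  unfold startPos
  omega

theorem IsHist.injOn (hh : IsHist f β σ h) : Set.InjOn (startPos h) (alive h) := by
  intro i hi j hj e
  have hi' := mem_alive.1 (Finset.mem_coe.1 hi)
  have hj' := mem_alive.1 (Finset.mem_coe.1 hj)
  unfold startPos at e
  exact hh.inj i hi j (Fin.ext (by omega))

theorem IsHist.update (hf : IsSmooth f m n q ρ β) {u : U} (hm : (σ ++ [u]).length ≤ m)
    (hh : IsHist f β σ h) (hi : (h i : ℕ) = 0) {x : Word w} (hx : (x : ℕ) = σ.length + 1) :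
    IsHist f β (σ ++ [u]) (Function.update h i x) := by
  have len : (σ ++ [u]).length = σ.length + 1 := List.length_append
  have old_ne (k : Fin L) : h k ≠ x := fun hk => by
    have := hh.hdr_le k
    rw [hk] at this
    omega
  refine ⟨fun j => ?_, fun j hj k e => ?_, fun p hp => ?_⟩
  · obtain rfl | hj := eq_or_ne j i
    · simp [hx]
    · simpa [hj] using (hh.hdr_le j).trans (Nat.le_succ _)
  · obtain hji | hji := eq_or_ne j i <;> obtain hki | hki := eq_or_ne k i
    · rw [hji, hki]
    · exact (old_ne k (by simpa [hji, hki] using e.symm)).elim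
    · exact (old_ne j (by simpa [hji, hki] using e)).elim
    · rw [alive_update (by omega), Finset.mem_insert] at hj
      exact hh.inj j (hj.resolve_left hji) k (by simpa [hji, hki] using e)
  · rw [alive_update (by omega)]
    obtain hp' | rfl := (Nat.lt_succ_iff.1 (hp.trans_eq len)).lt_or_eq
    · obtain ⟨j, hj, hjp⟩ := hh.covers p hp'
      have hji : j ≠ i := fun e => mem_alive.1 hj (e ▸ hi)
      refine ⟨j, Finset.mem_insert_of_mem hj, ?_⟩
      rw [startPos_congr (Function.update_of_ne hji x h)]
      exact hjp.append u
    · have start_eq : startPos (Function.update h i x) i = σ.length := by simp [startPos, hx]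
      refine ⟨i, Finset.mem_insert_self _ _, ?_⟩
      rw [start_eq]
      exact hf.coversAt_self hm hp

theorem IsHist.prune (hf : IsSmooth f m n q ρ β) (hβ : β ≤ 1) (ha : 0 ≤ a) (haβ : 4 * a ≤ β)
    (hm : σ.length ≤ m) (hh : IsHist f β σ h) (hv : Accurate f a σ (startPos h) v (alive h)) :
    IsHist f β σ ((histPolicy w L (1 - β / 2) W scale).prune h v) := by
  have hsub := pruned_subset (1 - β / 2) (startPos h) v (alive h)
  refine ⟨fun i => ?_, fun i hi j e => ?_, ?_⟩
  · by_cases hi : i ∈ pruned (1 - β / 2) (startPos h) v (alive h)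
    · rw [prune_eq hi]
      exact hh.hdr_le i
    · simp [histPolicy, hi, zeroWord]
  · have hj : j ∈ alive ((histPolicy w L (1 - β / 2) W scale).prune h v) := by
      rw [mem_alive, ← e]
      exact mem_alive.1 hi
    rw [alive_prune] at hi hj
    rw [prune_eq hi, prune_eq hj] at e
    exact hh.inj i (hsub hi) j e
  · rw [alive_prune]
    intro p hp
    obtain ⟨i, hi, hip⟩ := hh.covers.pruned hf hβ ha haβ hm (fun i hi => hh.startPos_lt hi) hv p hp
    exact ⟨i, hi, startPos_congr (prune_eq hi) ▸ hip⟩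

/-- The outputs that consist of an approximation of the value of `f` on the window and of the
scale of the noise that belongs to it. -/
def goodOutputs (f : List U → ℝ) (W : ℕ) (ρ : ℝ) (scale : ℝ → ℝ≥0) (σ : List U) :
    Set (Option (ℝ × ℝ≥0)) :=
  {o | ∃ v, o = some (v, scale v) ∧ RelApprox (2 * ρ) (f (σ.rtake W)) v}

theorem IsHist.some_res_mem_goodOutputs (hf : IsSmooth f m n q ρ β) (hρ : ρ ≤ 1 / 4) (ha : 0 ≤ a)
    (haβ : 4 * a ≤ β) (hm : σ.length ≤ m) (hσ : σ ≠ []) (hW : 1 ≤ W) (hh : IsHist f β σ h)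
    (hv : Accurate f a σ (startPos h) v (alive h)) {x : Word w} (hx : (x : ℕ) = σ.length) :
    some ((histPolicy w L θ W scale).res x h v) ∈ goodOutputs f W ρ scale σ := by
  have hp : (x : ℕ) - W < σ.length := by
    have := List.length_pos_of_ne_nil hσ
    omega
  have hex : ∃ i, IsLast h (x - W) i :=
    let ⟨i, hi, hip⟩ := hh.covers _ hp
    exists_isLast ⟨i, hi, hip.1⟩
  obtain ⟨halive, hle, hmax⟩ := hex.choose_spec
  refine ⟨v hex.choose, by simp [histPolicy, hex], ?_⟩
  rw [List.rtake, ← hx]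
  exact hh.covers.relApprox hf hρ ha haβ hm hv hp halive hle hmax

end histogram

/-! ### The failure probability of the histogram algorithm -/

theorem Policy.wp_update {w c L : ℕ} {O : Type} (P : Policy w L O) (p : Prog w c ℝ)
    (Φ : O × Mem w (numCells L c) → ℝ≥0∞) (M : Mem w (numCells L c)) :
    (P.update p).wp Φ M =
      (P.simulate p (succWord (M clk)) (P.alloc (succWord (M clk)) fun i => M (hdr i))
        (List.finRange L) 0).wp Φ (Function.update M clk (succWord (M clk))) := by
  have headers_eq : (fun i : Fin L => Function.update M clk (succWord (M clk)) (hdr i))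
      = fun i => M (hdr i) := by
    funext i
    simp [clk, hdr]
  change (P.load p (succWord (M clk)) (List.finRange L) fun _ => zeroWord w).wp Φ _ = _
  rw [Policy.load, Prog.wp_readHdrs _ _ _ _ _ fun i hi => absurd (List.mem_finRange i) hi,
    headers_eq]

section failure

open Prog StreamAlg

variable {w L : ℕ} {U : Type} {f : List U → ℝ} {m n q W N : ℕ} {ρ β a θ : ℝ} {scale : ℝ → ℝ≥0}
  {σ : List U} {x : Word w} {h : Fin L → Word w} {v : Fin L → ℝ} {i : Fin L}

theorem view_congr {c : ℕ} {M M' : Mem w (numCells L c)}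
    (hM : ∀ i j, M' (stamp i j) = M (stamp i j) ∧ M' (val i j) = M (val i j)) (i : Fin L)
    (y : Word w) : view M' i y = view M i y := by
  funext j
  simp only [view, hM i j]

/-- The state of the memory of the machine after the stream `σ`, as long as no copy has returned an
inaccurate output. -/
structure MemGood (c : ℕ) (f : List U → ℝ) (β : ℝ) (N : ℕ) (σ : List U)
    (M : Mem w (numCells L c)) : Prop where
  clk_eq : (M clk : ℕ) = σ.length
  stamp_le : ∀ i j, (M (stamp i j) : ℕ) ≤ σ.length
  hist : IsHist f β σ fun i => M (hdr i)
  card_le : (alive fun i => M (hdr i)).card ≤ 2 * N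

/-- The expected number of inaccurate outputs, during the remaining updates `τ`, of the copies that
are alive after the stream `σ`. -/
def aliveErrors (A : StreamAlg w U ℝ) (f : List U → ℝ) (a : ℝ) (τ σ : List U) (h : Fin L → Word w)
    (M : Mem w (numCells L A.cells)) : ℝ≥0∞ :=
  ∑ i ∈ alive h, A.futureErrors f a τ (σ.drop (startPos h i)) (view M i (h i))

variable (A : StreamAlg w U ℝ) {τ : List U} {M : Mem w (numCells L A.cells)} {C : ℝ≥0∞}

theorem aliveErrors_prune_le :
    aliveErrors A f a τ σ ((histPolicy w L θ W scale).prune h v) M ≤ aliveErrors A f a τ σ h M := by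
  rw [aliveErrors, alive_prune]
  refine (Finset.sum_congr rfl fun i hi => ?_).trans_le
    (Finset.sum_le_sum_of_subset (pruned_subset θ (startPos h) v (alive h)))
  rw [startPos_congr (prune_eq hi), prune_eq hi]

theorem MemGood.exists_alloc_eq {c : ℕ} {M : Mem w (numCells L c)} (hM : MemGood c f β N σ M)
    (hL : 2 * N < L) (x : Word w) :
    ∃ i, (M (hdr i) : ℕ) = 0 ∧ (histPolicy w L θ W scale).alloc x (fun i => M (hdr i))
      = Function.update (fun i => M (hdr i)) i x := by
  have hfree : ∃ i : Fin L, (M (hdr i) : ℕ) = 0 := by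
    by_contra! hne
    have alive_eq : (alive fun i : Fin L => M (hdr i)) = Finset.univ :=
      Finset.eq_univ_iff_forall.2 fun i => mem_alive.2 (hne i)
    have hcard := hM.card_le
    rw [alive_eq, Finset.card_fin] at hcard
    omega
  exact ⟨hfree.choose, hfree.choose_spec, dif_pos hfree⟩

theorem MemGood.aliveErrors_update (hM : MemGood A.cells f β N σ M) (hi : (M (hdr i) : ℕ) = 0)
    (hx : (x : ℕ) = σ.length + 1) :
    aliveErrors A f a τ σ (Function.update (fun i => M (hdr i)) i x) M
      = A.futureErrors f a τ [] (zeroMem w A.cells)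
        + aliveErrors A f a τ σ (fun i => M (hdr i)) M := by
  have start_eq : startPos (Function.update (fun i => M (hdr i)) i x) i = σ.length := by
    simp [startPos, hx]
  have view_eq : view M i x = zeroMem w A.cells := by
    funext j
    have hne : M (stamp i j) ≠ x := fun e => by
      have := hM.stamp_le i j
      rw [e] at this
      omega
    exact if_neg hne
  rw [aliveErrors, alive_update (by omega), Finset.sum_insert (by simp [mem_alive, hi]), start_eq,
    Function.update_self, view_eq, List.drop_length]
  refine congrArg _ (Finset.sum_congr rfl fun j hj => ?_)
  have hji : j ≠ i := fun e => mem_alive.1 hj (e ▸ hi)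
  rw [startPos_congr (Function.update_of_ne hji _ _), Function.update_of_ne hji]

theorem MemGood.prune {c : ℕ} {M : Mem w (numCells L c)} (hf : IsSmooth f m n q ρ β) (hβ : β ≤ 1)
    (ha : 0 ≤ a) (haβ : 4 * a ≤ β) (hN : (1 - β / 2) ^ N * (2 * (n : ℝ) ^ q) < 1 / 2)
    (hm : σ.length ≤ m) (hh : IsHist f β σ h) (hv : Accurate f a σ (startPos h) v (alive h))
    (hclk : (M clk : ℕ) = σ.length) (hstamp : ∀ i j, (M (stamp i j) : ℕ) ≤ σ.length)
    (hhdr : (fun i => M (hdr i)) = (histPolicy w L (1 - β / 2) W scale).prune h v) :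
    MemGood c f β N σ M where
  clk_eq := hclk
  stamp_le := hstamp
  hist := hhdr ▸ hh.prune hf hβ ha haβ hm hv
  card_le := by
    rw [hhdr, alive_prune]
    exact card_pruned_le hf hβ (by linarith) hm hh.injOn (fun i hi => hh.startPos_lt hi) hv hN

theorem wp_finish_le_of_accurate (hf : IsSmooth f m n q ρ β) (hρ : ρ ≤ 1 / 4) (ha : 0 ≤ a)
    (haβ : 4 * a ≤ β) (hW : 1 ≤ W) (hN : (1 - β / 2) ^ N * (2 * (n : ℝ) ^ q) < 1 / 2)
    (hσ : σ ≠ []) (hm : σ.length ≤ m) (hx : (x : ℕ) = σ.length) (hh : IsHist f β σ h)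
    (hv : Accurate f a σ (startPos h) v (alive h))
    {Φ : (ℝ × ℝ≥0) × Mem w (numCells L A.cells) → ℝ≥0∞}
    (hΦ : ∀ o M, MemGood A.cells f β N σ M → some o ∈ goodOutputs f W ρ scale σ →
      Φ (o, M) ≤ aliveErrors A f a τ σ (fun i => M (hdr i)) M + C)
    (hclk : M clk = x) (hstamp : ∀ i j, (M (stamp i j) : ℕ) ≤ σ.length) :
    ((histPolicy w L (1 - β / 2) W scale).finish A.cells x h (List.finRange L) v).wp Φ M
      ≤ aliveErrors A f a τ σ h M + C := by
  refine wp_writeHdrs_le _ _ _ _ _ _ fun M' hdr_eq other_eq => ?_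
  have clk_eq : M' clk = M clk := other_eq clk fun i _ => by simp [clk, hdr]
  have stamp_eq (i j) : M' (stamp i j) = M (stamp i j) :=
    other_eq _ fun i' _ => by simp [stamp, hdr]
  have val_eq (i j) : M' (val i j) = M (val i j) := other_eq _ fun i' _ => by simp [val, hdr]
  have headers_eq : (fun i => M' (hdr i)) = (histPolicy w L (1 - β / 2) W scale).prune h v :=
    funext fun i => hdr_eq i (List.mem_finRange i)
  have good : MemGood A.cells f β N σ M' :=
    .prune hf (by linarith [hf.le]) ha haβ hN hm hh hv (by rw [clk_eq, hclk, hx])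
      (fun i j => stamp_eq i j ▸ hstamp i j) headers_eq
  refine (hΦ _ M' good (hh.some_res_mem_goodOutputs hf hρ ha haβ hm hσ hW hv hx)).trans ?_
  gcongr
  rw [headers_eq]
  refine (aliveErrors_prune_le A).trans_eq ?_
  simp_rw [aliveErrors, view_congr fun i j => ⟨stamp_eq i j, val_eq i j⟩]

theorem wp_finish_le (hf : IsSmooth f m n q ρ β) (hρ : ρ ≤ 1 / 4) (ha : 0 ≤ a) (haβ : 4 * a ≤ β)
    (hW : 1 ≤ W) (hN : (1 - β / 2) ^ N * (2 * (n : ℝ) ^ q) < 1 / 2)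
    (hσ : σ ≠ []) (hm : σ.length ≤ m) (hx : (x : ℕ) = σ.length) (hh : IsHist f β σ h)
    {Φ : (ℝ × ℝ≥0) × Mem w (numCells L A.cells) → ℝ≥0∞} (hΦ₁ : ∀ y, Φ y ≤ 1)
    (hΦ : ∀ o M, MemGood A.cells f β N σ M → some o ∈ goodOutputs f W ρ scale σ →
      Φ (o, M) ≤ aliveErrors A f a τ σ (fun i => M (hdr i)) M + C)
    (v : Fin L → ℝ) (hclk : M clk = x) (hstamp : ∀ i j, (M (stamp i j) : ℕ) ≤ σ.length) :
    ((histPolicy w L (1 - β / 2) W scale).finish A.cells x h (List.finRange L) v).wp Φ M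
      ≤ ∑ i ∈ alive h, (inaccurate f a (σ.drop (startPos h i))).indicator 1 (v i)
        + aliveErrors A f a τ σ h M + C := by
  by_cases hv : Accurate f a σ (startPos h) v (alive h)
  · refine (wp_finish_le_of_accurate A hf hρ ha haβ hW hN hσ hm hx hh hv hΦ hclk hstamp).trans ?_
    gcongr
    exact le_add_self
  · obtain ⟨i, hi, hbad⟩ : ∃ i ∈ alive h, v i ∈ inaccurate f a (σ.drop (startPos h i)) := by
      simpa only [Accurate, not_forall, exists_prop, inaccurate, Set.mem_compl_iff,
        Set.mem_ofPred_eq] using hv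
    calc _ ≤ 1 := (wp_mono _ hΦ₁ M).trans (wp_const _ _ _).le
      _ = (inaccurate f a (σ.drop (startPos h i))).indicator 1 (v i) := by simp [hbad]
      _ ≤ ∑ i ∈ alive h, (inaccurate f a (σ.drop (startPos h i))).indicator 1 (v i) :=
        Finset.single_le_sum (f := fun i => (inaccurate f a (σ.drop (startPos h i))).indicator 1
          (v i)) (fun _ _ => zero_le) hi
      _ ≤ _ := by
        rw [add_assoc]
        exact le_self_add

theorem wp_simulate_le (hf : IsSmooth f m n q ρ β) (hρ : ρ ≤ 1 / 4) (ha : 0 ≤ a) (haβ : 4 * a ≤ β)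
    (hW : 1 ≤ W) (hN : (1 - β / 2) ^ N * (2 * (n : ℝ) ^ q) < 1 / 2) {u : U}
    (hm : (σ ++ [u]).length ≤ m) (hx : (x : ℕ) = (σ ++ [u]).length) (hh : IsHist f β (σ ++ [u]) h)
    {Φ : (ℝ × ℝ≥0) × Mem w (numCells L A.cells) → ℝ≥0∞} (hΦ₁ : ∀ y, Φ y ≤ 1)
    (hΦ : ∀ o M, MemGood A.cells f β N (σ ++ [u]) M → some o ∈ goodOutputs f W ρ scale (σ ++ [u]) →
      Φ (o, M) ≤ aliveErrors A f a τ (σ ++ [u]) (fun i => M (hdr i)) M + C)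
    (hclk : M clk = x) (hstamp : ∀ i j, (M (stamp i j) : ℕ) ≤ σ.length) :
    ((histPolicy w L (1 - β / 2) W scale).simulate (A.step u) x h (List.finRange L) 0).wp Φ M
      ≤ aliveErrors A f a (u :: τ) σ h M + C := by
  classical
  have len : (σ ++ [u]).length = σ.length + 1 := List.length_append
  let g (i : Fin L) (y : ℝ × Mem w A.cells) : ℝ≥0∞ := if i ∈ alive h then
    (inaccurate f a ((σ ++ [u]).drop (startPos h i))).indicator 1 y.1
      + A.futureErrors f a τ ((σ ++ [u]).drop (startPos h i)) y.2 else 0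
  have sum_eq (F : Fin L → ℝ≥0∞) : ∑ i, (if i ∈ alive h then F i else 0) = ∑ i ∈ alive h, F i := by
    rw [← Finset.sum_filter, Finset.filter_mem_eq_inter, Finset.univ_inter]
  have wp_g (i : Fin L) : (A.step u).wp (g i) (view M i (h i)) = if i ∈ alive h then
      A.futureErrors f a (u :: τ) (σ.drop (startPos h i)) (view M i (h i)) else 0 := by
    by_cases hi : i ∈ alive h
    · have hlt := hh.startPos_lt hi
      simp only [g, hi, if_true, StreamAlg.futureErrors,
        List.drop_append_of_le_length (show startPos h i ≤ σ.length by omega)]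
    · simp only [g, hi, if_false]
      exact wp_const _ _ _
  refine (wp_runSlots_le (A.step u) h _ Φ g C M (fun v M' hM' => ?_) (List.finRange L)
    (List.nodup_finRange L) 0 M ⟨rfl, fun _ _ => .inl rfl⟩).trans_eq ?_
  · rw [sum_eq, Finset.sum_add_distrib]
    refine wp_finish_le A hf hρ ha haβ hW hN (by simp) hm hx hh hΦ₁ hΦ v (hM'.clk_eq.trans hclk)
      fun i j => ?_
    obtain e | e := hM'.stamp_or i j
    · rw [e, len]
      exact (hstamp i j).trans (Nat.le_succ _)
    · rw [e]
      exact hh.hdr_le i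
  · simp only [List.mem_finRange, if_true, wp_g, sum_eq, aliveErrors]

theorem future_le (hf : IsSmooth f m n q ρ β) (hρ : ρ ≤ 1 / 4) (ha : 0 ≤ a) (haβ : 4 * a ≤ β)
    (hW : 1 ≤ W) (hN : (1 - β / 2) ^ N * (2 * (n : ℝ) ^ q) < 1 / 2) (hL : 2 * N < L)
    (hmw : m < 2 ^ w) (hm : (σ ++ τ).length ≤ m) (hM : MemGood A.cells f β N σ M)
    {o : Option (ℝ × ℝ≥0)} (ho : τ = [] → o ∈ goodOutputs f W ρ scale σ) :
    ((histPolicy w L (1 - β / 2) W scale).alg A).future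
        ((goodOutputs f W ρ scale (σ ++ τ))ᶜ.indicator 1) τ (o, M)
      ≤ aliveErrors A f a τ σ (fun i => M (hdr i)) M + A.birthErrors f a τ := by
  induction τ generalizing σ o M with
  | nil => simp [StreamAlg.future, ho rfl]
  | cons u τ ih =>
    have len : (σ ++ [u]).length = σ.length + 1 := List.length_append
    rw [List.append_cons] at hm ⊢
    have hm' : (σ ++ [u]).length ≤ m := (σ ++ [u]).sublist_append_left τ |>.length_le.trans hm
    have hx : (succWord (M clk) : ℕ) = σ.length + 1 := by
      simp only [succWord, hM.clk_eq]
      exact Nat.mod_eq_of_lt (by omega)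
    obtain ⟨i, hi, alloc_eq⟩ := hM.exists_alloc_eq hL (succWord (M clk))
    have view_eq : view (Function.update M clk (succWord (M clk))) = view M :=
      funext₂ <| view_congr fun i j => by simp [clk, stamp, val]
    have step := wp_simulate_le A (C := A.birthErrors f a τ)
      (M := Function.update M clk (succWord (M clk))) (τ := τ) hf hρ ha haβ hW hN hm'
      (hx.trans len.symm) (hM.hist.update hf hm' hi hx)
      (Φ := fun y => ((histPolicy w L (1 - β / 2) W scale).alg A).future
        ((goodOutputs f W ρ scale (σ ++ [u] ++ τ))ᶜ.indicator 1) τ (some y.1, y.2))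
      (fun y => future_le_one _ (Set.indicator_le fun _ _ => le_rfl) _ _)
      (fun o M hM ho => ih hm hM fun _ => ho) (Function.update_self _ _ _)
      (fun i j => by simpa [clk, stamp] using hM.stamp_le i j)
    rw [aliveErrors, view_eq, ← aliveErrors, hM.aliveErrors_update A hi hx, ← alloc_eq] at step
    refine (Policy.wp_update _ _ _ _).trans_le (step.trans_eq ?_)
    rw [StreamAlg.birthErrors]
    ring

theorem outputLaw_compl_goodOutputs_le {d : ℝ} (hA : A.IsApprox f m a d) (hd : 0 ≤ d)
    (hd' : d ≤ 1) (hf : IsSmooth f m n q ρ β) (hρ : ρ ≤ 1 / 4) (ha : 0 ≤ a) (haβ : 4 * a ≤ β)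
    (hW : 1 ≤ W) (hN : (1 - β / 2) ^ N * (2 * (n : ℝ) ^ q) < 1 / 2) (hL : 2 * N < L)
    (hmw : m < 2 ^ w) (hσ : σ.length = m) (hσ₀ : σ ≠ []) :
    (((histPolicy w L (1 - β / 2) W scale).alg A).outputLaw σ).toOuterMeasure
      (goodOutputs f W ρ scale σ)ᶜ ≤ ENNReal.ofReal ((m : ℝ) ^ 2 * d) := by
  have alive_eq : alive (fun i : Fin L => zeroMem w (numCells L A.cells) (hdr i)) = ∅ :=
    Finset.filter_eq_empty_iff.2 fun i _ => not_not.2 rfl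
  have good : MemGood (L := L) A.cells f β N [] (zeroMem w (numCells L A.cells)) :=
    ⟨rfl, fun _ _ => le_rfl, ⟨fun _ => le_rfl, by simp [alive_eq], by simp [Covers]⟩,
      by simp [alive_eq]⟩
  rw [← expect_indicator, expect_outputLaw]
  calc _ ≤ _ := future_le A (σ := []) (τ := σ) hf hρ ha haβ hW hN hL hmw hσ.le good (absurd · hσ₀)
    _ = A.birthErrors f a σ := by rw [aliveErrors, alive_eq, Finset.sum_empty, zero_add]
    _ ≤ σ.length * m * ENNReal.ofReal d := A.birthErrors_le hA hd hd' σ hσ.le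
    _ = ENNReal.ofReal ((m : ℝ) ^ 2 * d) := by
      rw [hσ, ENNReal.ofReal_mul (by positivity), ENNReal.ofReal_pow (by positivity),
        ENNReal.ofReal_natCast, sq]

end failure

/-! ### The Laplace distribution -/

section laplace

open MeasureTheory

variable (x : ℝ) {x' y : ℝ} {b b' : ℝ≥0} {r s t : ℝ}

theorem laplace_apply (hb : 0 < b) {E : Set ℝ} (hE : MeasurableSet E) : laplace x b E =
    ∫⁻ y in E, ENNReal.ofReal (1 / (2 * b) * Real.exp (-|y - x| / b)) := by
  rw [laplace, if_neg hb.ne', withDensity_apply _ hE]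

theorem laplace_preimage_reflect (hb : 0 < b) {E : Set ℝ} (hE : MeasurableSet E) :
    laplace x b ((fun y => 2 * x - y) ⁻¹' E) = laplace x b E := by
  have reflect := Measure.measurePreserving_sub_left (volume : Measure ℝ) (2 * x)
  rw [laplace_apply x hb (reflect.measurable hE), laplace_apply x hb hE,
    ← reflect.setLIntegral_comp_preimage hE (by fun_prop)]
  congr! 6 with y
  rw [show 2 * x - y - x = x - y by ring, abs_sub_comm]

theorem laplace_Ioi (hb : 0 < b) (ht : 0 ≤ t) :
    laplace x b (Set.Ioi (x + t)) = ENNReal.ofReal (Real.exp (-t / b) / 2) := by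
  have hneg : -(1 / (b : ℝ)) < 0 := by simp [hb]
  have density_eq : ∀ y ∈ Set.Ioi (x + t), ENNReal.ofReal (1 / (2 * b) * Real.exp (-|y - x| / b))
      = ENNReal.ofReal (1 / (2 * b) * Real.exp (x / b) * Real.exp (-(1 / (b : ℝ)) * y)) := by
    intro y hy
    rw [abs_of_nonneg (by linarith [Set.mem_Ioi.1 hy]), mul_assoc, ← Real.exp_add]
    congr 3
    ring
  rw [laplace_apply x hb measurableSet_Ioi, setLIntegral_congr_fun measurableSet_Ioi density_eq,
    ← ofReal_integral_eq_lintegral_ofReal ((integrableOn_exp_mul_Ioi hneg _).const_mul _)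
      (.of_forall fun y => by simp only [Pi.zero_apply]; positivity),
    integral_const_mul, integral_exp_mul_Ioi hneg,
    show -t / (b : ℝ) = x / b + -(1 / (b : ℝ)) * (x + t) by ring, Real.exp_add]
  congr 1
  field_simp

theorem laplace_Iio (hb : 0 < b) (ht : 0 ≤ t) :
    laplace x b (Set.Iio (x - t)) = ENNReal.ofReal (Real.exp (-t / b) / 2) := by
  rw [← laplace_Ioi x hb ht, ← laplace_preimage_reflect x hb measurableSet_Ioi,
    Set.preimage_const_sub_Ioi, show 2 * x - (x + t) = x - t by ring]

theorem laplace_tail (hb : 0 < b) (ht : 0 ≤ t) :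
    laplace x b {y | t * b < |y - x|} = ENNReal.ofReal (Real.exp (-t)) := by
  have tail_eq : {y | t * b < |y - x|} = Set.Iio (x - t * b) ∪ Set.Ioi (x + t * b) := by
    ext y
    simp only [Set.mem_ofPred_eq, lt_abs, Set.mem_union, Set.mem_Iio, Set.mem_Ioi]
    constructor <;> rintro (h | h) <;> [right; left; right; left] <;> linarith
  have disj : Disjoint (Set.Iio (x - t * b)) (Set.Ioi (x + t * b)) :=
    (Set.Iic_disjoint_Ioi (by linarith [mul_nonneg ht b.coe_nonneg])).mono_left
      Set.Iio_subset_Iic_self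
  rw [tail_eq, measure_union disj measurableSet_Ioi, laplace_Iio x hb (by positivity),
    laplace_Ioi x hb (by positivity), ← ENNReal.ofReal_add (by positivity) (by positivity),
    add_halves, neg_div, mul_div_cancel_right₀ _ (NNReal.coe_pos.2 hb).ne']

instance isProbabilityMeasure_laplace : IsProbabilityMeasure (laplace x b) := by
  obtain rfl | hb := eq_zero_or_pos b
  · rw [laplace, if_pos rfl]
    infer_instance
  · have compl_eq : ({x}ᶜ : Set ℝ) = {y | 0 * (b : ℝ) < |y - x|} := by
      ext y
      simp [sub_eq_zero]
    refine ⟨?_⟩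
    rw [← measure_add_measure_compl (measurableSet_singleton x), compl_eq,
      laplace_tail x hb le_rfl, laplace_apply x hb (measurableSet_singleton x)]
    simp

theorem ofReal_one_sub_exp_le_laplace (hb : 0 < b) (ht : 0 ≤ t) {I : Set ℝ}
    (hI : MeasurableSet I) (hx : ∀ y, |y - x| ≤ t * b → y ∈ I) :
    ENNReal.ofReal (1 - Real.exp (-t)) ≤ laplace x b I := by
  have compl_le : laplace x b Iᶜ ≤ ENNReal.ofReal (Real.exp (-t)) :=
    laplace_tail x hb ht ▸ measure_mono fun y hy => not_le.1 fun hle => hy (hx y hle)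
  rw [ENNReal.ofReal_sub _ (Real.exp_nonneg _), ENNReal.ofReal_one, tsub_le_iff_right,
    ← prob_add_prob_compl (μ := laplace x b) hI]
  gcongr

variable {x} in
theorem laplace_density_le (hb : 0 < b) (hb' : 0 < b') (hx : |x - x'| ≤ s * b')
    (h₁ : (b' : ℝ) - b ≤ r * b) (h₂ : (b : ℝ) - b' ≤ r * b') (hy : |y - x| ≤ t * b) :
    1 / (2 * b) * Real.exp (-|y - x| / b)
      ≤ Real.exp (s + r + r * t) * (1 / (2 * b') * Real.exp (-|y - x'| / b')) := by
  rw [← NNReal.coe_pos] at hb hb'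
  have hr : 0 ≤ r := by
    by_contra! hr
    nlinarith
  have scale_le : 1 / (2 * (b : ℝ)) ≤ Real.exp r * (1 / (2 * b')) := by
    have : (b' : ℝ) ≤ Real.exp r * b := by nlinarith [Real.add_one_le_exp r]
    rw [mul_one_div, div_le_div_iff₀ (by positivity) (by positivity)]
    linarith
  have rescale_le : |y - x| / (b' : ℝ) ≤ |y - x| / b + r * t := by
    have ratio_le : (b : ℝ) / b' ≤ 1 + r := by
      rw [div_le_iff₀ hb']
      linarith
    calc |y - x| / (b' : ℝ) = |y - x| / b * (b / b') := by field_simp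
      _ ≤ |y - x| / b * (1 + r) := by gcongr
      _ = |y - x| / b + r * (|y - x| / b) := by ring
      _ ≤ |y - x| / b + r * t := by
        gcongr
        exact (div_le_iff₀ hb).2 hy
  have recenter_le : |y - x'| / b' ≤ |y - x| / b' + s := by
    rw [div_le_iff₀ hb', add_mul, div_mul_cancel₀ _ hb'.ne']
    exact (abs_sub_le y x x').trans (by gcongr)
  calc _ ≤ Real.exp r * (1 / (2 * b')) * Real.exp (s + r * t + -|y - x'| / b') := by
        gcongr
        rw [neg_div, neg_div]
        linarith
    _ = _ := by
        rw [Real.exp_add, show s + r + r * t = r + (s + r * t) by ring, Real.exp_add r]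
        ring

variable {x} in
theorem laplace_le (hb : 0 < b) (hb' : 0 < b') (ht : 0 ≤ t) (hx : |x - x'| ≤ s * b')
    (h₁ : (b' : ℝ) - b ≤ r * b) (h₂ : (b : ℝ) - b' ≤ r * b') {E : Set ℝ} (hE : MeasurableSet E) :
    laplace x b E ≤ ENNReal.ofReal (Real.exp (s + r + r * t)) * laplace x' b' E
      + ENNReal.ofReal (Real.exp (-t)) := by
  set R : Set ℝ := {y | |y - x| ≤ t * b}
  have measurable_R : MeasurableSet R := measurableSet_le (by fun_prop) measurable_const
  have compl_eq : Rᶜ = {y | t * b < |y - x|} := by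
    ext y
    exact not_le (a := |y - x|)
  have inter_le : laplace x b (E ∩ R)
      ≤ ENNReal.ofReal (Real.exp (s + r + r * t)) * laplace x' b' (E ∩ R) := by
    rw [laplace_apply x hb (hE.inter measurable_R), laplace_apply x' hb' (hE.inter measurable_R),
      ← lintegral_const_mul' _ _ ENNReal.ofReal_ne_top]
    refine setLIntegral_mono' (hE.inter measurable_R) fun y hy => ?_
    rw [← ENNReal.ofReal_mul (Real.exp_pos _).le]
    exact ENNReal.ofReal_le_ofReal (laplace_density_le hb hb' hx h₁ h₂ hy.2)
  calc laplace x b E ≤ laplace x b (E ∩ R) + laplace x b Rᶜ :=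
        (measure_le_inter_add_sdiff _ E R).trans
          (add_le_add_right (measure_mono (Set.sdiff_subset_compl E R)) _)
    _ ≤ _ := by
        rw [compl_eq, laplace_tail x hb ht]
        gcongr
        exact inter_le.trans (by gcongr; exact Set.inter_subset_left)

end laplace

/-! ### Releasing a noisy output -/

section release

open MeasureTheory

theorem expect_const_mul {α : Type*} (μ : PMF α) (K : ℝ≥0∞) (φ : α → ℝ≥0∞) :
    expect μ (fun a => K * φ a) = K * expect μ φ := by
  simp_rw [expect, ← ENNReal.tsum_mul_left, mul_left_comm]

theorem expect_le_mul_expect_add {α γ : Type*} (μ : PMF α) (ν : PMF γ) {φ : α → ℝ≥0∞}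
    {ψ : γ → ℝ≥0∞} {G : Set α} {H : Set γ} {K δ : ℝ≥0∞} (hφ : ∀ a, φ a ≤ 1)
    (h : ∀ a ∈ G, ∀ b ∈ H, φ a ≤ K * ψ b + δ) :
    expect μ φ ≤ K * expect ν ψ + δ + ν.toOuterMeasure Hᶜ + μ.toOuterMeasure Gᶜ := by
  refine expect_le_of_forall_mem μ (fun a ha => ?_) hφ
  refine (le_expect_of_forall_mem ν (h a ha) (hφ a)).trans_eq ?_
  rw [expect_add, expect_const_mul, expect_const]

/-- The probability that the number released for a given output of an algorithm lies in `E`. -/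
def releaseProb (E : Set ℝ) : Option (ℝ × ℝ≥0) → ℝ≥0∞
  | none => 0
  | some o => laplace o.1 o.2 E

theorem releaseProb_le_one (E : Set ℝ) (o : Option (ℝ × ℝ≥0)) : releaseProb E o ≤ 1 := by
  cases o with
  | none => exact zero_le_one
  | some o => exact prob_le_one

theorem releaseLaw_apply {w : ℕ} {U : Type} (A : StreamAlg w U (ℝ × ℝ≥0)) (σ : List U) {E : Set ℝ}
    (hE : MeasurableSet E) : A.releaseLaw σ E = expect (A.outputLaw σ) (releaseProb E) := by
  rw [StreamAlg.releaseLaw, Measure.sum_apply _ hE, expect,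
    ← (Option.some_injective (ℝ × ℝ≥0)).tsum_eq fun o ho => ?_]
  · rfl
  · cases o with
    | none => simp [releaseProb] at ho
    | some o => exact ⟨o, rfl⟩

end release

/-! ### Sensitivity of the window -/

section sensitivity

variable {U : Type} {σ τ : List U}

theorem globalSensitivity_nonneg (f : List U → ℝ) (ℓ : ℕ) : 0 ≤ globalSensitivity f ℓ := by
  refine Real.sSup_nonneg ?_
  rintro d ⟨σ, τ, -, -, -, rfl⟩
  exact abs_nonneg _

theorem abs_sub_le_globalSensitivity [Finite U] (f : List U → ℝ) {ℓ : ℕ} (hσ : σ.length = ℓ)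
    (hτ : τ.length = ℓ) (h : Neighboring σ τ) : |f σ - f τ| ≤ globalSensitivity f ℓ := by
  refine le_csSup (Set.Finite.bddAbove ?_) ⟨σ, τ, hσ, hτ, h, rfl⟩
  have finite_length := List.finite_length_eq U ℓ
  refine ((finite_length.prod finite_length).image fun x => |f x.1 - f x.2|).subset ?_
  rintro d ⟨σ, τ, h₁, h₂, -, rfl⟩
  exact ⟨(σ, τ), ⟨h₁, h₂⟩, rfl⟩

theorem Neighboring.drop (h : Neighboring σ τ) (k : ℕ) :
    σ.drop k = τ.drop k ∨ Neighboring (σ.drop k) (τ.drop k) := by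
  obtain ⟨l, r, a, b, rfl, rfl⟩ := h
  obtain hk | hk := le_or_gt k l.length
  · right
    rw [List.drop_append_of_le_length hk, List.drop_append_of_le_length hk]
    exact ⟨l.drop k, r, a, b, rfl, rfl⟩
  · left
    obtain ⟨d, rfl⟩ := Nat.exists_eq_add_of_lt hk
    simp only [List.drop_length_add_append, add_assoc, List.drop_succ_cons]

theorem abs_sub_rtake_le [Finite U] (f : List U → ℝ) {m : ℕ} (W : ℕ) (hσ : σ.length = m)
    (hτ : τ.length = m) (h : Neighboring σ τ) :
    |f (σ.rtake W) - f (τ.rtake W)| ≤ globalSensitivity f (min m W) := by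
  have length_drop {η : List U} (hη : η.length = m) : (η.drop (m - W)).length = min m W := by
    rw [List.length_drop, hη]
    omega
  rw [List.rtake, List.rtake, hσ, hτ]
  obtain drop_eq | neighboring := h.drop (m - W)
  · rw [drop_eq, sub_self, abs_zero]
    exact globalSensitivity_nonneg _ _
  · exact abs_sub_le_globalSensitivity f (length_drop hσ) (length_drop hτ) neighboring

theorem IsSmooth.one_le_rtake {f : List U → ℝ} {m n q W : ℕ} {ρ β : ℝ}
    (hf : IsSmooth f m n q ρ β) (hσ : σ.length ≤ m) (hσ₀ : σ ≠ []) (hW : 1 ≤ W) :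
    1 ≤ f (σ.rtake W) :=
  hf.one_le_drop hσ (by have := List.length_pos_of_ne_nil hσ₀; omega)

end sensitivity

/-! ### Noise proportional to the estimate -/

section noise

/-- The scale of the noise added to the estimate `v`. It is a multiple of `Δ + 8 ρ v`, which bounds
the distance between two approximations of values at distance `Δ` up to a constant factor. -/
def noiseScale (Δ ρ ε v : ℝ) : ℝ≥0 := (3 / 2 * (Δ + 8 * ρ * v) / ε).toNNReal

variable {Δ ρ ε g g' v v' : ℝ}

theorem RelApprox.pos {a : ℝ} (hv : RelApprox a g v) (ha : a < 1) (hg : 0 < g) : 0 < v :=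
  (mul_pos (sub_pos.2 ha) hg).trans_le hv.1

theorem coe_noiseScale (hΔ : 0 ≤ Δ) (hρ : 0 ≤ ρ) (hε : 0 ≤ ε) (hv : 0 ≤ v) :
    (noiseScale Δ ρ ε v : ℝ) = 3 / 2 * (Δ + 8 * ρ * v) / ε :=
  Real.coe_toNNReal _ (by positivity)

theorem noiseScale_pos (hΔ : 0 ≤ Δ) (hρ : 0 < ρ) (hε : 0 < ε) (hv : 0 < v) :
    0 < noiseScale Δ ρ ε v :=
  Real.toNNReal_pos.2 (by positivity)

theorem abs_sub_le_of_relApprox (hρ : 0 ≤ ρ) (hρ' : ρ ≤ 1 / 40) (hgg : |g - g'| ≤ Δ)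
    (hv : RelApprox (2 * ρ) g v) (hv' : RelApprox (2 * ρ) g' v') :
    |v - v'| ≤ 9 / 8 * (Δ + 8 * ρ * v') := by
  obtain ⟨hv₁, hv₂⟩ := hv
  obtain ⟨hv₁', hv₂'⟩ := hv'
  have error_le : ρ * g ≤ 2 * (ρ * v) := by nlinarith
  have error_le' : ρ * g' ≤ 2 * (ρ * v') := by nlinarith
  have abs_le_add : |v - v'| ≤ Δ + 4 * (ρ * v) + 4 * (ρ * v') := by
    obtain ⟨h₁, h₂⟩ := abs_le.1 hgg
    rw [abs_le]
    constructor <;> linarith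
  have transfer : ρ * v ≤ ρ * v' + |v - v'| / 40 := by
    nlinarith [le_abs_self (v - v'), abs_nonneg (v - v')]
  linarith [(abs_nonneg _).trans hgg]

theorem abs_sub_le_noiseScale (hΔ : 0 ≤ Δ) (hρ : 0 ≤ ρ) (hρ' : ρ ≤ 1 / 40) (hε : 0 < ε)
    (hg' : 0 < g') (hgg : |g - g'| ≤ Δ) (hv : RelApprox (2 * ρ) g v)
    (hv' : RelApprox (2 * ρ) g' v') : |v - v'| ≤ 3 / 4 * ε * noiseScale Δ ρ ε v' := by
  rw [coe_noiseScale hΔ hρ hε.le (hv'.pos (by linarith) hg').le]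
  refine (abs_sub_le_of_relApprox hρ hρ' hgg hv hv').trans_eq ?_
  field_simp
  ring

theorem noiseScale_sub_le (hΔ : 0 ≤ Δ) (hρ : 0 ≤ ρ) (hρ' : ρ ≤ 1 / 40) (hε : 0 < ε)
    (hg : 0 < g) (hg' : 0 < g') (hgg : |g - g'| ≤ Δ) (hv : RelApprox (2 * ρ) g v)
    (hv' : RelApprox (2 * ρ) g' v') :
    (noiseScale Δ ρ ε v : ℝ) - noiseScale Δ ρ ε v' ≤ 9 * ρ * noiseScale Δ ρ ε v' := by
  calc (noiseScale Δ ρ ε v : ℝ) - noiseScale Δ ρ ε v' = 12 * ρ / ε * (v - v') := by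
        rw [coe_noiseScale hΔ hρ hε.le (hv.pos (by linarith) hg).le,
          coe_noiseScale hΔ hρ hε.le (hv'.pos (by linarith) hg').le]
        ring
    _ ≤ 12 * ρ / ε * (3 / 4 * ε * noiseScale Δ ρ ε v') := by
        gcongr
        exact (le_abs_self _).trans (abs_sub_le_noiseScale hΔ hρ hρ' hε hg' hgg hv hv')
    _ = 9 * ρ * noiseScale Δ ρ ε v' := by
        field_simp
        ring

theorem laplace_noiseScale_le {t : ℝ} (hρ : 0 < ρ) (hρ' : ρ ≤ 1 / 40) (hε : 0 < ε) (ht : 0 ≤ t)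
    (hρt : 36 * ρ * (1 + t) ≤ ε) (hg : 0 < g) (hg' : 0 < g') (hgg : |g - g'| ≤ Δ)
    (hv : RelApprox (2 * ρ) g v) (hv' : RelApprox (2 * ρ) g' v') {E : Set ℝ}
    (hE : MeasurableSet E) :
    laplace v (noiseScale Δ ρ ε v) E
      ≤ ENNReal.ofReal (Real.exp ε) * laplace v' (noiseScale Δ ρ ε v') E
        + ENNReal.ofReal (Real.exp (-t)) := by
  have hΔ : 0 ≤ Δ := (abs_nonneg _).trans hgg
  refine (laplace_le (noiseScale_pos hΔ hρ hε (hv.pos (by linarith) hg))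
    (noiseScale_pos hΔ hρ hε (hv'.pos (by linarith) hg')) ht
    (abs_sub_le_noiseScale hΔ hρ.le hρ' hε hg' hgg hv hv')
    (noiseScale_sub_le hΔ hρ.le hρ' hε hg' hg (abs_sub_comm g g' ▸ hgg) hv' hv)
    (noiseScale_sub_le hΔ hρ.le hρ' hε hg hg' hgg hv hv') hE).trans ?_
  gcongr
  linarith

theorem mem_Icc_of_abs_sub_le_mul_noiseScale {α t y : ℝ} (hΔ : 0 ≤ Δ) (hρ : 0 ≤ ρ)
    (hρ' : ρ ≤ 1 / 40) (hε : 0 < ε) (hg : 0 < g) (hρα : 4 * ρ ≤ α) (htα : 48 * ρ * t / ε ≤ α)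
    (hv : RelApprox (2 * ρ) g v) (hy : |y - v| ≤ t * noiseScale Δ ρ ε v) :
    y ∈ Set.Icc ((1 - α) * g - 3 / 2 * Δ * t / ε) ((1 + α) * g + 3 / 2 * Δ * t / ε) := by
  have hv₀ : 0 < v := hv.pos (by linarith) hg
  obtain ⟨hv₁, hv₂⟩ := hv
  have dev_eq : t * (noiseScale Δ ρ ε v : ℝ) = 3 / 2 * Δ * t / ε + 48 * ρ * t / ε * (v / 4) := by
    rw [coe_noiseScale hΔ hρ hε.le hv₀.le]
    ring
  have noise_le : 48 * ρ * t / ε * (v / 4) ≤ α * g / 2 :=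
    calc 48 * ρ * t / ε * (v / 4) ≤ α * (v / 4) := by gcongr
      _ ≤ α * g / 2 := by nlinarith [show v ≤ 2 * g by nlinarith]
  have approx_le : 2 * ρ * g ≤ α * g / 2 := by nlinarith
  obtain ⟨h₁, h₂⟩ := abs_le.1 (dev_eq ▸ hy)
  constructor <;> linarith

end noise

/-! ### Privacy and accuracy of the release -/

section release

variable {w m n q W : ℕ} {U : Type} {A : StreamAlg w U (ℝ × ℝ≥0)} {f : List U → ℝ}
  {ρ β ε t D δ : ℝ}

theorem isDP_of_outputLaw_compl_goodOutputs_le [Finite U] (hf : IsSmooth f m n q ρ β) (hm : 1 ≤ m)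
    (hW : 1 ≤ W) (hρ : 0 < ρ) (hρ' : ρ ≤ 1 / 40) (hε : 0 < ε) (ht : 0 ≤ t)
    (hρt : 36 * ρ * (1 + t) ≤ ε) (hD₀ : 0 ≤ D) (hδ : Real.exp (-t) + 2 * D ≤ δ)
    (hD : ∀ σ : List U, σ.length = m → (A.outputLaw σ).toOuterMeasure
      (goodOutputs f W ρ (noiseScale (globalSensitivity f (min m W)) ρ ε) σ)ᶜ
        ≤ ENNReal.ofReal D) :
    IsDP A.releaseLaw m ε δ := by
  intro σ τ hσ hτ hστ E hE
  set Δ := globalSensitivity f (min m W)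
  have one_le {η : List U} (hη : η.length = m) : 0 < f (η.rtake W) :=
    one_pos.trans_le (hf.one_le_rtake hη.le (List.ne_nil_of_length_pos (by omega)) hW)
  have good_le : ∀ o ∈ goodOutputs f W ρ (noiseScale Δ ρ ε) σ,
      ∀ o' ∈ goodOutputs f W ρ (noiseScale Δ ρ ε) τ, releaseProb E o
        ≤ ENNReal.ofReal (Real.exp ε) * releaseProb E o' + ENNReal.ofReal (Real.exp (-t)) := by
    rintro _ ⟨v, rfl, hv⟩ _ ⟨v', rfl, hv'⟩
    exact laplace_noiseScale_le hρ hρ' hε ht hρt (one_le hσ) (one_le hτ)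
      (abs_sub_rtake_le f W hσ hτ hστ) hv hv' hE
  rw [releaseLaw_apply A σ hE, releaseLaw_apply A τ hE]
  refine (expect_le_mul_expect_add _ (A.outputLaw τ) (releaseProb_le_one E) good_le).trans ?_
  rw [add_assoc, add_assoc]
  gcongr
  calc _ ≤ ENNReal.ofReal (Real.exp (-t)) + (ENNReal.ofReal D + ENNReal.ofReal D) := by
        gcongr
        exacts [hD τ hτ, hD σ hσ]
    _ = ENNReal.ofReal (Real.exp (-t) + 2 * D) := by
        rw [← ENNReal.ofReal_add hD₀ hD₀, ← ENNReal.ofReal_add (by positivity) (by positivity),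
          two_mul]
    _ ≤ ENNReal.ofReal δ := ENNReal.ofReal_le_ofReal hδ

theorem ofReal_one_sub_le_releaseLaw {Δ α : ℝ} {σ : List U} (hf : 0 < f (σ.rtake W)) (hΔ : 0 ≤ Δ)
    (hρ : 0 < ρ) (hρ' : ρ ≤ 1 / 40) (hε : 0 < ε) (ht : 0 ≤ t) (hD₀ : 0 ≤ D)
    (hδ : Real.exp (-t) + D ≤ δ) (hρα : 4 * ρ ≤ α) (htα : 48 * ρ * t / ε ≤ α)
    (hD : (A.outputLaw σ).toOuterMeasure (goodOutputs f W ρ (noiseScale Δ ρ ε) σ)ᶜ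
      ≤ ENNReal.ofReal D) :
    ENNReal.ofReal (1 - δ) ≤ A.releaseLaw σ
      (Set.Icc ((1 - α) * f (σ.rtake W) - 3 / 2 * Δ * t / ε)
        ((1 + α) * f (σ.rtake W) + 3 / 2 * Δ * t / ε)) := by
  set I := Set.Icc ((1 - α) * f (σ.rtake W) - 3 / 2 * Δ * t / ε)
    ((1 + α) * f (σ.rtake W) + 3 / 2 * Δ * t / ε)
  have le_of_good : ∀ o ∈ goodOutputs f W ρ (noiseScale Δ ρ ε) σ,
      ENNReal.ofReal (1 - Real.exp (-t)) ≤ releaseProb I o := by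
    rintro _ ⟨v, rfl, hv⟩
    exact ofReal_one_sub_exp_le_laplace v (noiseScale_pos hΔ hρ hε (hv.pos (by linarith) hf)) ht
      measurableSet_Icc fun y => mem_Icc_of_abs_sub_le_mul_noiseScale hΔ hρ.le hρ' hε hf hρα htα hv
  calc ENNReal.ofReal (1 - δ) ≤ ENNReal.ofReal (1 - Real.exp (-t) - D) :=
        ENNReal.ofReal_le_ofReal (by linarith)
    _ = ENNReal.ofReal (1 - Real.exp (-t)) - ENNReal.ofReal D := ENNReal.ofReal_sub _ hD₀
    _ ≤ A.releaseLaw σ I := by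
      rw [tsub_le_iff_right, releaseLaw_apply A σ measurableSet_Icc]
      refine (le_expect_of_forall_mem _ le_of_good ?_).trans (by gcongr)
      exact ENNReal.ofReal_le_one.2 (by linarith [Real.exp_pos (-t)])

end release

/-! ### Choice of the parameters -/

section parameters

variable {q b m n : ℕ} {β κ : ℝ}

theorem half_le_log (hm : 2 ≤ m) : 1 / 2 ≤ Real.log m := by
  have log_two_le : Real.log 2 ≤ Real.log m := Real.log_le_log two_pos (mod_cast hm)
  linarith [Real.log_two_gt_d9]

theorem one_sub_pow_lt_inv {x y : ℝ} {N : ℕ} (hx : x ≤ 1) (hy : 0 < y)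
    (h : Real.log y < N * x) : (1 - x) ^ N < y⁻¹ :=
  calc (1 - x) ^ N ≤ Real.exp (-x) ^ N :=
        pow_le_pow_left₀ (sub_nonneg.2 hx) (Real.one_sub_le_exp_neg x) N
    _ = Real.exp (-(N * x)) := by rw [← Real.exp_nat_mul, mul_neg]
    _ < Real.exp (-Real.log y) := Real.exp_lt_exp.2 (neg_lt_neg h)
    _ = y⁻¹ := by rw [Real.exp_neg, Real.exp_log hy]

/-- Half of the maximal number of copies that survive the pruning: the estimates lie in `[1/2, 2nᵠ]`
and lose a factor `1 - β / 2` from every copy to the second next one. -/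
def halfSlots (q b m : ℕ) (β : ℝ) : ℕ := ⌊2 / β * ((2 + q * b) * Real.log m)⌋₊ + 1

theorem pow_halfSlots_mul_lt (hm : 2 ≤ m) (hn : n ≤ m ^ b) (hβ : 0 < β) (hβ' : β ≤ 1) :
    (1 - β / 2) ^ halfSlots q b m β * (2 * (n : ℝ) ^ q) < 1 / 2 := by
  have hmR : (2 : ℝ) ≤ m := mod_cast hm
  have log_lt : Real.log ((m : ℝ) ^ (2 + q * b)) < halfSlots q b m β * (β / 2) := by
    rw [← div_lt_iff₀ (by positivity), Real.log_pow, halfSlots]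
    push_cast
    convert Nat.lt_floor_add_one _ using 1
    field_simp
  have pow_lt := one_sub_pow_lt_inv (by linarith) (by positivity) log_lt
  have pow_nonneg : 0 ≤ (1 - β / 2) ^ halfSlots q b m β := pow_nonneg (by linarith) _
  have pow_le : (n : ℝ) ^ q ≤ (m : ℝ) ^ (q * b) := by
    rw [mul_comm q b, pow_mul]
    gcongr
    exact_mod_cast hn
  calc (1 - β / 2) ^ halfSlots q b m β * (2 * (n : ℝ) ^ q)
      ≤ (1 - β / 2) ^ halfSlots q b m β * (2 * (m : ℝ) ^ (q * b)) := by gcongr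
    _ < ((m : ℝ) ^ (2 + q * b))⁻¹ * (2 * (m : ℝ) ^ (q * b)) := by gcongr
    _ = 2 / (m : ℝ) ^ 2 := by
        rw [pow_add]
        field_simp
    _ ≤ 1 / 2 := by
        rw [div_le_div_iff₀ (by positivity) two_pos]
        nlinarith

/-- The number of slots of the machine is at most `slotConst q b * log m / β`. -/
def slotConst (q b : ℕ) : ℝ := 14 + 4 * (q * b)

theorem le_slotConst : 14 ≤ slotConst q b := by
  rw [slotConst]
  linarith [show (0 : ℝ) ≤ 4 * (q * b) by positivity]

theorem half_le_log_div (hm : 2 ≤ m) (hβ : 0 < β) (hβ' : β ≤ 1) : 1 / 2 ≤ Real.log m / β :=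
  (half_le_log hm).trans (le_div_self (Real.log_natCast_nonneg m) hβ hβ')

theorem two_mul_halfSlots_add_one_le (hm : 2 ≤ m) (hβ : 0 < β) (hβ' : β ≤ 1) :
    ((2 * halfSlots q b m β + 1 : ℕ) : ℝ) ≤ slotConst q b * (Real.log m / β) := by
  have floor_le : (⌊2 / β * ((2 + q * b) * Real.log m)⌋₊ : ℝ)
      ≤ 2 * (2 + q * b) * (Real.log m / β) :=
    (Nat.floor_le (by positivity)).trans_eq (by ring)
  rw [halfSlots, slotConst]
  push_cast
  linarith [half_le_log_div hm hβ hβ']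

/-- The constant in the bounds on the space and the update time; `κ` bounds the ratio of the word
size to `log m`. -/
def resourceConst (q b : ℕ) (κ : ℝ) : ℝ :=
  8 * slotConst q b + 24 + (2 * slotConst q b + 4) * |κ|

theorem mul_slotConst_add_le : 8 * slotConst q b + 24 ≤ resourceConst q b κ := by
  rw [resourceConst]
  have := le_slotConst (q := q) (b := b)
  linarith [show 0 ≤ (2 * slotConst q b + 4) * |κ| by positivity]

theorem one_le_resourceConst (q b : ℕ) (κ : ℝ) : 1 ≤ resourceConst q b κ := by
  linarith [le_slotConst (q := q) (b := b), mul_slotConst_add_le (q := q) (b := b) (κ := κ)]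

variable {L w : ℕ} {S T : ℝ}

theorem time_le_of_slots_le (hm : 2 ≤ m) (hβ : 0 < β) (hβ' : β ≤ 1) (hT : 0 ≤ T)
    (hL : (L : ℝ) ≤ slotConst q b * (Real.log m / β)) :
    (4 * L + 3) * T ≤ resourceConst q b κ * (1 / β * T * Real.log m) := by
  have hZ := half_le_log_div hm hβ hβ'
  have := le_slotConst (q := q) (b := b)
  calc (4 * L + 3) * T ≤ (8 * slotConst q b + 24) * (Real.log m / β) * T := by
        gcongr
        nlinarith
    _ ≤ resourceConst q b κ * (Real.log m / β) * T := by
        gcongr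
        exact mul_slotConst_add_le
    _ = _ := by ring

theorem space_le_of_slots_le (hm : 2 ≤ m) (hβ : 0 < β) (hβ' : β ≤ 1) (hS : 0 ≤ S)
    (hw : (w : ℝ) ≤ κ * Real.log m) (hL : (L : ℝ) ≤ slotConst q b * (Real.log m / β)) :
    (4 * L + 2) * S + (2 * L + 2) * w + 3 * L + 4
      ≤ resourceConst q b κ * (1 / β * (S + Real.log m) * Real.log m) := by
  have hlog := half_le_log hm
  have hZ := half_le_log_div hm hβ hβ'
  have hK := le_slotConst (q := q) (b := b)
  have eq_add : resourceConst q b κ * (1 / β * (S + Real.log m) * Real.log m)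
      = resourceConst q b κ * (Real.log m / β) * S
        + (2 * slotConst q b + 4) * (Real.log m / β) * (|κ| * Real.log m)
        + (8 * slotConst q b + 24) * (Real.log m / β) * Real.log m := by
    rw [resourceConst]
    ring
  generalize Real.log m / β = Z at *
  have space_le : (4 * L + 2) * S ≤ resourceConst q b κ * Z * S :=
    calc (4 * L + 2) * S ≤ (8 * slotConst q b + 24) * Z * S := by
          gcongr
          nlinarith
      _ ≤ resourceConst q b κ * Z * S := by
          gcongr
          exact mul_slotConst_add_le
  have words_le : (2 * L + 2) * (w : ℝ) ≤ (2 * slotConst q b + 4) * Z * (|κ| * Real.log m) := by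
    gcongr
    · linarith
    · exact hw.trans (by gcongr; exact le_abs_self κ)
  have rest_le : 3 * L + 4 ≤ (8 * slotConst q b + 24) * Z * Real.log m :=
    calc (3 * L + 4 : ℝ) ≤ (8 * slotConst q b + 24) * Z * (1 / 2) := by nlinarith
      _ ≤ (8 * slotConst q b + 24) * Z * Real.log m := by gcongr
  linarith

theorem sq_mul_div_pow_le (hm : 2 ≤ m) (hn : 1 ≤ n) (j : ℕ) {y : ℝ} (hy : 0 ≤ y) :
    (m : ℝ) ^ 2 * (y / ((m : ℝ) * n) ^ (2 + j)) ≤ y * (1 / 2) ^ j := by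
  have hmR : (2 : ℝ) ≤ m := mod_cast hm
  have hnR : (1 : ℝ) ≤ n := mod_cast hn
  have pow_le : (m : ℝ) ^ 2 * 2 ^ j ≤ ((m : ℝ) * n) ^ (2 + j) := by
    rw [pow_add]
    gcongr <;> nlinarith
  calc (m : ℝ) ^ 2 * (y / ((m : ℝ) * n) ^ (2 + j))
      ≤ (m : ℝ) ^ 2 * (y / ((m : ℝ) ^ 2 * 2 ^ j)) := by gcongr
    _ = y * (1 / 2) ^ j := by
        rw [one_div, inv_pow]
        field_simp

theorem exp_neg_mul_log (hm : 2 ≤ m) (c : ℝ) :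
    Real.exp (-(c * Real.log m)) = (m : ℝ) ^ (-c) := by
  rw [Real.rpow_def_of_pos (by positivity)]
  congr 1
  ring

theorem exists_sq_mul_div_pow_le {c : ℝ} (hc : 0 < c) :
    ∃ k : ℕ, ∀ m n : ℕ, 2 ≤ m → 1 ≤ n →
      (m : ℝ) ^ 2 * ((m : ℝ) ^ (-c) / ((m : ℝ) * n) ^ k) ≤ (m : ℝ) ^ (-c) / 4 ∧
      (m : ℝ) ^ 2 * ((m : ℝ) ^ (-c) / ((m : ℝ) * n) ^ k)
        ≤ (m : ℝ) ^ (-c) * (1 - Real.exp (-(3 * c * Real.log 2))) := by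
  have slack_pos : 0 < 1 - Real.exp (-(3 * c * Real.log 2)) :=
    sub_pos.2 (Real.exp_lt_one_iff.2 (neg_lt_zero.2 (by positivity)))
  obtain ⟨j, hj⟩ := exists_pow_lt_of_lt_one (lt_min (by norm_num : (0 : ℝ) < 1 / 4) slack_pos)
    one_half_lt_one
  refine ⟨2 + j, fun m n hm hn => ?_⟩
  have le_mul := sq_mul_div_pow_le hm hn j (Real.rpow_nonneg m.cast_nonneg (-c))
  constructor
  · refine le_mul.trans ?_
    rw [div_eq_mul_one_div (_ ^ (-c))]
    gcongr
    exact hj.le.trans (min_le_left _ _)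
  · refine le_mul.trans ?_
    gcongr
    exact hj.le.trans (min_le_right _ _)

theorem rpow_neg_div_pow_lt_one {c : ℝ} (hc : 0 < c) (hm : 2 ≤ m) (hn : 1 ≤ n) (k : ℕ) :
    (m : ℝ) ^ (-c) / ((m : ℝ) * n) ^ k < 1 := by
  have hmR : (1 : ℝ) < m := mod_cast hm
  have hnR : (1 : ℝ) ≤ n := mod_cast hn
  exact (div_le_self (by positivity) (one_le_pow₀ (by nlinarith))).trans_lt
    (Real.rpow_lt_one_of_one_lt_of_neg hmR (neg_lt_zero.2 hc))

theorem bounds_of_le_mul_min_div {c α ε ρ : ℝ} (hc : 0 ≤ c) (hm : 2 ≤ m) (hα : 0 < α) (hα' : α < 1)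
    (hε : 0 < ε) (hρ₀ : 0 < ρ) (hρ : ρ ≤ α * min ε 1 / (200 * (c + 3) * Real.log m)) :
    ρ ≤ 1 / 40 ∧ 4 * ρ ≤ α ∧ 200 * (c + 3) * (ρ * Real.log m) ≤ ε ∧
      200 * (c + 3) * (ρ * Real.log m) ≤ α * ε := by
  have hlog := half_le_log hm
  have le_mul_min : 200 * (c + 3) * (ρ * Real.log m) ≤ α * min ε 1 := by
    rw [le_div_iff₀ (by positivity)] at hρ
    linarith
  have le_mul_eps := le_mul_min.trans (mul_le_mul_of_nonneg_left (min_le_left ε 1) hα.le)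
  have le_alpha := le_mul_min.trans (mul_le_of_le_one_right hα.le (min_le_right ε 1))
  have mul_rho_le : 300 * ρ ≤ 200 * (c + 3) * (ρ * Real.log m) := by
    nlinarith [mul_le_mul_of_nonneg_left hlog hρ₀.le, show 0 ≤ c * (ρ * Real.log m) by positivity]
  exact ⟨by linarith, by linarith, le_mul_eps.trans (mul_le_of_le_one_left hε.le hα'.le),
    le_mul_eps⟩

end parameters

/-! ### The smooth histogram algorithm -/

section smoothHist

variable {w : ℕ} {U : Type} {m n q b W : ℕ} {f : List U → ℝ} {c α ρ β ε d κ S T : ℝ}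
  (A : StreamAlg w U ℝ)

/-- The private smooth histogram built from the insertion-only algorithm `A`. -/
def smoothHist (f : List U → ℝ) (q b m W : ℕ) (β ρ ε : ℝ) : StreamAlg w U (ℝ × ℝ≥0) :=
  (histPolicy w (2 * halfSlots q b m β + 1) (1 - β / 2) W
    (noiseScale (globalSensitivity f (min m W)) ρ ε)).alg A

theorem smoothHist_compl_goodOutputs_le (hf : IsSmooth f m n q ρ β) (hρ : ρ ≤ 1 / 4) (hm : 2 ≤ m)
    (hn : n ≤ m ^ b) (hmw : m < 2 ^ w) (hW : 1 ≤ W) (hA : A.IsApprox f m (β / 4) d) (hd : 0 ≤ d)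
    (hd' : d ≤ 1) {σ : List U} (hσ : σ.length = m) :
    ((smoothHist A f q b m W β ρ ε).outputLaw σ).toOuterMeasure
      (goodOutputs f W ρ (noiseScale (globalSensitivity f (min m W)) ρ ε) σ)ᶜ
        ≤ ENNReal.ofReal ((m : ℝ) ^ 2 * d) :=
  have hβ := hf.pos
  outputLaw_compl_goodOutputs_le A hA hd hd' hf hρ (by positivity) (by linarith) hW
    (pow_halfSlots_mul_lt hm hn hβ (by linarith [hf.le])) (Nat.lt_succ_self _) hmw hσ
    (List.ne_nil_of_length_pos (by omega))

theorem isDP_smoothHist [Finite U] (hf : IsSmooth f m n q ρ β) (hc : 0 ≤ c) (hm : 2 ≤ m)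
    (hn : n ≤ m ^ b) (hmw : m < 2 ^ w) (hW : 1 ≤ W) (hρ₀ : 0 < ρ) (hρ : ρ ≤ 1 / 40) (hε : 0 < ε)
    (hρε : 200 * (c + 3) * (ρ * Real.log m) ≤ ε) (hA : A.IsApprox f m (β / 4) d) (hd : 0 ≤ d)
    (hd' : (m : ℝ) ^ 2 * d ≤ (m : ℝ) ^ (-c) / 4) :
    IsDP (smoothHist A f q b m W β ρ ε).releaseLaw m ε ((m : ℝ) ^ (-c)) := by
  have hlog := half_le_log hm
  have hmR : (2 : ℝ) ≤ m := mod_cast hm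
  have hcρ : 0 ≤ c * (ρ * Real.log m) := by positivity
  have exp_le : Real.exp (-((c + 1) * Real.log m)) ≤ (m : ℝ) ^ (-c) / 2 := by
    rw [exp_neg_mul_log hm, neg_add, ← sub_eq_add_neg, Real.rpow_sub_one (by positivity)]
    gcongr
  have hd₁ : d ≤ 1 := by
    have := Real.rpow_le_one_of_one_le_of_nonpos (x := m) (z := -c) (by linarith) (by linarith)
    nlinarith
  refine isDP_of_outputLaw_compl_goodOutputs_le hf (by omega) hW hρ₀ hρ hε
    (t := (c + 1) * Real.log m) (by positivity) ?_ (by positivity) (by linarith) fun σ hσ =>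
      smoothHist_compl_goodOutputs_le A hf (by linarith) hm hn hmw hW hA hd hd₁ hσ
  nlinarith [mul_le_mul_of_nonneg_left hlog hρ₀.le]

theorem ofReal_one_sub_le_releaseLaw_smoothHist (hf : IsSmooth f m n q ρ β)
    (hc : 0 ≤ c) (hm : 2 ≤ m) (hn : n ≤ m ^ b) (hmw : m < 2 ^ w) (hW : 1 ≤ W) (hρ₀ : 0 < ρ)
    (hρ : ρ ≤ 1 / 40) (hε : 0 < ε) (hρα : 4 * ρ ≤ α)
    (hραε : 200 * (c + 3) * (ρ * Real.log m) ≤ α * ε) (hA : A.IsApprox f m (β / 4) d)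
    (hd : 0 ≤ d) (hd' : (m : ℝ) ^ 2 * d ≤ (m : ℝ) ^ (-c) * (1 - Real.exp (-(3 * c * Real.log 2))))
    {σ : List U} (hσ : σ.length = m) :
    ENNReal.ofReal (1 - (m : ℝ) ^ (-c)) ≤ (smoothHist A f q b m W β ρ ε).releaseLaw σ
      (Set.Icc
        ((1 - α) * f (σ.rtake W) - 6 * c * globalSensitivity f (min m W) * Real.log m / ε)
        ((1 + α) * f (σ.rtake W) + 6 * c * globalSensitivity f (min m W) * Real.log m / ε)) := by
  have hmR : (2 : ℝ) ≤ m := mod_cast hm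
  have hlog := half_le_log hm
  have hρlog : 0 ≤ ρ * Real.log m := by positivity
  have rpow_pos : 0 < (m : ℝ) ^ (-c) := by positivity
  have exp_le : Real.exp (-(4 * c * Real.log m))
      ≤ (m : ℝ) ^ (-c) * Real.exp (-(3 * c * Real.log 2)) := by
    rw [← exp_neg_mul_log hm c, ← Real.exp_add, Real.exp_le_exp]
    have : c * Real.log 2 ≤ c * Real.log m := by gcongr
    linarith
  have hd₁ : d ≤ 1 := by
    have rpow_le := Real.rpow_le_one_of_one_le_of_nonpos (x := m) (z := -c) (by linarith)
      (by linarith)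
    have := mul_pos rpow_pos (Real.exp_pos (-(3 * c * Real.log 2)))
    nlinarith
  have error_eq : 3 / 2 * globalSensitivity f (min m W) * (4 * c * Real.log m) / ε
      = 6 * c * globalSensitivity f (min m W) * Real.log m / ε := by ring
  rw [← error_eq]
  refine ofReal_one_sub_le_releaseLaw
    (one_pos.trans_le (hf.one_le_rtake hσ.le (List.ne_nil_of_length_pos (by omega)) hW))
    (globalSensitivity_nonneg f _) hρ₀ hρ hε (by positivity) (by positivity) (by linarith) hρα ?_
    (smoothHist_compl_goodOutputs_le A hf (by linarith) hm hn hmw hW hA hd hd₁ hσ)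
  rw [div_le_iff₀ hε]
  nlinarith [mul_nonneg hc hρlog]

theorem spaceBits_smoothHist_le [Finite U] (hm : 2 ≤ m) (hβ : 0 < β) (hβ' : β ≤ 1)
    (hw : (w : ℝ) ≤ κ * Real.log m) (hA : A.spaceBits ≤ S) :
    (smoothHist A f q b m W β ρ ε).spaceBits
      ≤ resourceConst q b κ * (1 / β * (S + Real.log m) * Real.log m) := by
  have hS : 0 ≤ S := (add_nonneg (by positivity) (logb_two_natCast_nonneg _)).trans hA
  refine (Policy.spaceBits_alg_le _ A).trans <| le_trans ?_ <|
    space_le_of_slots_le hm hβ hβ' hS hw (two_mul_halfSlots_add_one_le hm hβ hβ')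
  gcongr

theorem updateTimeLE_smoothHist (hm : 2 ≤ m) (hβ : 0 < β) (hβ' : β ≤ 1) (hA : A.UpdateTimeLE T) :
    (smoothHist A f q b m W β ρ ε).UpdateTimeLE
      (resourceConst q b κ * (1 / β * T * Real.log m)) := by
  intro u
  have hT : 0 ≤ T := le_trans (by positivity) (hA u)
  exact (Policy.updateTimeLE_alg _ A hA u).trans
    (time_le_of_slots_le hm hβ hβ' hT (two_mul_halfSlots_add_one_le hm hβ hβ'))

end smoothHist

end DPHist

end

open DPHist in
theorem mainTheorem4_general (c : ℝ) (hc : 0 < c) (q b : ℕ) (κ : ℝ) :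
    ∃ (C₁ C₂ C₃ : ℝ) (k : ℕ), 1 ≤ C₁ ∧ 1 ≤ C₂ ∧ 1 ≤ C₃ ∧
      ∀ (U : Type) [Finite U] (m n w W : ℕ) (α ε ρ : ℝ) (f : List U → ℝ) (β : ℝ → ℝ)
        (S T : ℝ → ℝ → ℕ → ℕ → ℝ),
        2 ≤ m → 1 ≤ n → n ≤ m ^ b →
        m < 2 ^ w → (w : ℝ) ≤ κ * Real.log m →
        1 ≤ W → 0 < α → α < 1 → 0 < ε →
        0 < ρ → ρ ≤ α * min ε 1 / (C₁ * Real.log m) →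
        IsSmooth f m n q ρ (β ρ) →
        (∀ a d : ℝ, 0 < a → a < 1 → 0 < d → d < 1 →
          ∃ A : StreamAlg w U ℝ, A.IsApprox f m a d ∧
            A.spaceBits ≤ S a d m n ∧ A.UpdateTimeLE (T a d m n)) →
        ∃ A' : StreamAlg w U (ℝ × NNReal),
          IsDP A'.releaseLaw m ε ((m : ℝ) ^ (-c)) ∧
          (∀ σ : List U, σ.length = m →
            ENNReal.ofReal (1 - (m : ℝ) ^ (-c)) ≤ A'.releaseLaw σ
              {y | (1 - α) * f (σ.rtake W)
                      - 6 * c * globalSensitivity f (min m W) * Real.log m / ε ≤ y ∧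
                   y ≤ (1 + α) * f (σ.rtake W)
                      + 6 * c * globalSensitivity f (min m W) * Real.log m / ε}) ∧
          A'.spaceBits ≤ C₃ * (1 / β ρ *
            (S (β ρ / C₂) ((m : ℝ) ^ (-c) / ((m : ℝ) * n) ^ k) m n + Real.log m) * Real.log m) ∧
          A'.UpdateTimeLE (C₃ * (1 / β ρ *
            T (β ρ / C₂) ((m : ℝ) ^ (-c) / ((m : ℝ) * n) ^ k) m n * Real.log m)) := by
  obtain ⟨k, hk⟩ := exists_sq_mul_div_pow_le hc
  refine ⟨200 * (c + 3), 4, resourceConst q b κ, k, by linarith, by norm_num,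
    one_le_resourceConst q b κ, ?_⟩
  intro U _ m n w W α ε ρ f β S T hm hn hnm hmw hw hW hα hα' hε hρ₀ hρ hf hA
  obtain ⟨privacy_failure, accuracy_failure⟩ := hk m n hm hn
  obtain ⟨hρ', hρα, hρε, hραε⟩ := bounds_of_le_mul_min_div hc.le hm hα hα' hε hρ₀ hρ
  have hβ := hf.pos
  have hβ' : β ρ ≤ 1 := by linarith [hf.le]
  have hd : 0 < (m : ℝ) ^ (-c) / ((m : ℝ) * n) ^ k := by positivity
  obtain ⟨A, hA, hS, hT⟩ := hA (β ρ / 4) _ (by positivity) (by linarith) hd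
    (rpow_neg_div_pow_lt_one hc hm hn k)
  exact ⟨smoothHist A f q b m W (β ρ) ρ ε,
    isDP_smoothHist A hf hc.le hm hnm hmw hW hρ₀ hρ' hε hρε hA hd.le privacy_failure,
    fun σ hσ => ofReal_one_sub_le_releaseLaw_smoothHist A hf hc.le hm hnm hmw hW hρ₀ hρ' hε hρα
      hραε hA hd.le accuracy_failure hσ,
    spaceBits_smoothHist_le A hm hβ hβ' hw hS, updateTimeLE_smoothHist A hm hβ hβ' hT⟩

open DPHist in
theorem mainTheorem4 (c : ℝ) (hc : 0 < c) (q b : ℕ) (κ : ℝ) :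
    ∃ (C₁ C₂ C₃ : ℝ) (k : ℕ), 1 ≤ C₁ ∧ 1 ≤ C₂ ∧ 1 ≤ C₃ ∧
      ∀ (U : Type) [Finite U] (m n w W : ℕ) (α ε ρ : ℝ) (f : List U → ℝ) (β : ℝ → ℝ)
        (S T : ℝ → ℝ → ℕ → ℕ → ℝ),
        2 ≤ m → m ≤ n ^ b → n ≤ m ^ b →
        m < 2 ^ w → (w : ℝ) ≤ κ * Real.log m →
        1 ≤ W → 0 < α → α < 1 → 0 < ε →
        0 < ρ → ρ ≤ α * min ε 1 / (C₁ * Real.log m) →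
        IsSmooth f m n q ρ (β ρ) →
        (∀ a d : ℝ, 0 < a → a < 1 → 0 < d → d < 1 →
          ∃ A : StreamAlg w U ℝ, A.IsApprox f m a d ∧
            A.spaceBits ≤ S a d m n ∧ A.UpdateTimeLE (T a d m n)) →
        ∃ A' : StreamAlg w U (ℝ × NNReal),
          IsDP A'.releaseLaw m ε ((m : ℝ) ^ (-c)) ∧
          (∀ σ : List U, σ.length = m →
            ENNReal.ofReal (1 - (m : ℝ) ^ (-c)) ≤ A'.releaseLaw σ
              {y | (1 - α) * f (σ.rtake W)
                      - 6 * c * globalSensitivity f (min m W) * Real.log m / ε ≤ y ∧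
                   y ≤ (1 + α) * f (σ.rtake W)
                      + 6 * c * globalSensitivity f (min m W) * Real.log m / ε}) ∧
          A'.spaceBits ≤ C₃ * (1 / β ρ *
            (S (β ρ / C₂) ((m : ℝ) ^ (-c) / ((m : ℝ) * n) ^ k) m n + Real.log m) * Real.log m) ∧
          A'.UpdateTimeLE (C₃ * (1 / β ρ *
            T (β ρ / C₂) ((m : ℝ) ^ (-c) / ((m : ℝ) * n) ^ k) m n * Real.log m)) := by
  obtain ⟨C₁, C₂, C₃, k, hC₁, hC₂, hC₃, framework⟩ := mainTheorem4_general c hc q b κ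
  exact ⟨C₁, C₂, C₃, k, hC₁, hC₂, hC₃, fun U _ m n w W α ε ρ f β S T hm hmn =>
    framework U m n w W α ε ρ f β S T hm
      (lt_of_pow_lt_pow_left₀ b n.zero_le ((zero_pow_le_one b).trans_lt (hm.trans hmn)))⟩
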